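/- For $\kappa,\mu\in\mathbb C$ let $W_{\kappa,\mu}:(0,\infty)\to\mathbb C$ be the Whittaker function, i.e. the unique solution of \[W''(y)+\left(-\frac14+\frac{\kappa}{y}+\frac{\frac14-\mu^2}{y^2}\right)W(y)=0\qquad (y>0)\] with $\lim_{y\to\infty}y^{-\kappa}e^{y/2}W(y)=1$. For $k\in\mathbb Z$ and $\alpha,\beta,\gamma\in\mathbb R$ put \[I_k(\alpha,\beta,\gamma)=\int_0^\infty \frac{W_{0,i\alpha}(y)}{\Gamma(\frac12+i\alpha)}\left(\frac{W_{k,i\beta}(y)}{\Gamma(\frac12+k+i\beta)}+\frac{W_{-k,i\beta}(y)}{\Gamma(\frac12-k+i\beta)}\right)y^{-\frac12+i\gamma}\,\frac{\mathrm dy}{y}.\] Then for every $k\in\mathbb Z$ the integral $I_k(r,-r,t)$ converges absolutely for all $r,t\in\mathbb R$, and there is a constant $C_k>0$, depending only on $k$, such that for all $r,t\in\mathbb R$ \[|I_k(r,-r,t)|\le C_k\,(1+|t|)^{-\frac12}(1+|2r+t|)^{-\frac14}(1+|2r-t|)^{-\frac14}.\] -/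

import Mathlib

open Filter Topology MeasureTheory

/-- `IsWhittakerW κ μ W` says that `W`, restricted to `(0, ∞)`, is the Whittaker function
`W_{κ,μ}`: it solves Whittaker's equation
`W'' + (-1/4 + κ / y + (1/4 - μ ^ 2) / y ^ 2) W = 0` on `(0, ∞)` and satisfies
`y ^ (-κ) * e ^ (y / 2) * W y → 1` as `y → ∞`. For all complex `κ`, `μ` there is exactly one such
function on `(0, ∞)`, as every solution that is not a multiple of it grows like
`y ^ (-κ) * e ^ (y / 2)`. -/
structure IsWhittakerW (κ μ : ℂ) (W : ℝ → ℂ) : Prop where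
  differentiableAt : ∀ y : ℝ, 0 < y → DifferentiableAt ℝ W y
  equation : ∀ y : ℝ, 0 < y →
    HasDerivAt (deriv W)
      (-((-(1 / 4) + κ / (y : ℂ) + (1 / 4 - μ ^ 2) / (y : ℂ) ^ 2) * W y)) y
  asymptotic :
    Tendsto (fun y : ℝ => (y : ℂ) ^ (-κ) * Complex.exp ((y : ℂ) / 2) * W y) atTop (𝓝 1)

/-- The Whittaker function `W_{κ,μ}` on `(0, ∞)`: the solution of Whittaker's equation that is
asymptotic to `y ^ κ * e ^ (-y / 2)` at infinity. Its values at `y ≤ 0` carry no meaning. -/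
noncomputable def whittakerW (κ μ : ℂ) : ℝ → ℂ :=
  Classical.epsilon (IsWhittakerW κ μ)

/-- The integrand, with respect to `dy` on `(0, ∞)`, of the Whittaker integral `I_k(α, β, γ)`. -/
noncomputable def whittakerIntegrand (k : ℤ) (α β γ : ℝ) (y : ℝ) : ℂ :=
  whittakerW 0 (Complex.I * α) y / Complex.Gamma (1 / 2 + Complex.I * α) *
    (whittakerW (k : ℂ) (Complex.I * β) y / Complex.Gamma (1 / 2 + (k : ℂ) + Complex.I * β) +
      whittakerW (-(k : ℂ)) (Complex.I * β) y /
        Complex.Gamma (1 / 2 - (k : ℂ) + Complex.I * β)) *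
    (y : ℂ) ^ (-(1 / 2) + Complex.I * γ : ℂ) / (y : ℂ)

/-- The Whittaker integral `I_k(α, β, γ)`. -/
noncomputable def whittakerIntegral (k : ℤ) (α β γ : ℝ) : ℂ :=
  ∫ y in Set.Ioi (0 : ℝ), whittakerIntegrand k α β γ y

/-! For integral `k` the functions w_k = W_{k,ir} are real and linked by first-order ladder
operators. Put V_k = w_k / Γ(1/2 + k - ir) and S_k = V_k + V_{-k}. Contiguity becomes y S_k' = ½((k
- 1/2 + ir) S_{k-1} - (1/2 + k - ir) S_{k+1}), and I_k(r,-r,t) is Γ(1/2 + ir)⁻¹ M_k(σ), where M_k(σ)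
= ∫ w_0 S_k y^{σ-1} dy and σ = -1/2 + it. With N_k(σ) = ∫ y w_0' S_k y^{σ-1} dy, integration by
parts and the equation of w_0 express M_{k+1}, N_{k+1} through the indices k and k - 1
(`evenMellin_succ`, `evenMellinDeriv_succ`). Such a recurrence would need two initial indices, but
S_{-1} = S_1 makes the index 0 suffice; this is the role of the sum of two Whittaker functions in
I_k.

At index 0, S_0 is a multiple of w_0 = √(y/π) K_{ir}(y/2), so M_0 is an explicit product of Gamma
functions (`integral_whittakerZero_sq`), and N_0 = -(σ/2) M_0.

Let ρ = 1 + |r| + |t| and L = ρ / (1 + |r|). Each step of the recurrence divides by |1/2 + k - ir|,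
of order 1 + |r|, and costs at most a factor ρ; hence |M_k| ≤ C L^|k| |M_0| (`evenMellinBound`). The
decay of Γ on Re z = 1/4 (`exists_norm_Gamma_quarter_le`) bounds the case k = 0 by the claimed
algebraic factors times exp(-(π/2) e), where e = |t/2 + r| + |t/2 - r| - 2|r| ≥ 0. Since L ≤ 3 + e,
this exponential absorbs L^|k| (`exists_pow_mul_exp_le`): L is large only where |t| is much larger
than |r|, and there the integral decays exponentially.

As `whittakerW` is defined by choice, existence and uniqueness of w_k are also needed: uniqueness
comes from the Wronskian, existence from the Bessel integral at k = 0 and the ladder operators. -/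

/-! ### Uniqueness of the Whittaker function -/

/-- A solution of a linear equation `D'' = q D` on `(0, ∞)` with `q` bounded on `[a, b]` that
vanishes to first order at `b` vanishes at `a`. -/
lemma eq_zero_of_hasDerivAt_of_eq_zero {D D' : ℝ → ℂ} {q : ℝ → ℂ} {a b K : ℝ} (hab : a ≤ b)
    (hD : ∀ y ∈ Set.Icc a b, HasDerivAt D (D' y) y)
    (hD' : ∀ y ∈ Set.Icc a b, HasDerivAt D' (q y * D y) y)
    (hq : ∀ y ∈ Set.Icc a b, ‖q y‖ ≤ K) (hb : D b = 0) (hb' : D' b = 0) : D a = 0 := by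
  have key := ODE_solution_unique_of_mem_Icc_left (E := ℂ × ℂ)
    (v := fun t x => (x.2, q t * x.1)) (s := fun _ => Set.univ)
    (K := (max 1 K).toNNReal) (f := fun y => (D y, D' y)) (g := fun _ => 0) (a := a) (b := b)
    ?_ ?_ ?_ (fun _ _ => trivial) continuousOn_const ?_ (fun _ _ => trivial) (by simp [hb, hb'])
  · have := key (Set.left_mem_Icc.2 hab)
    simpa using congrArg Prod.fst this
  · intro t ht
    apply LipschitzOnWith.of_dist_le_mul
    intro x _ y _
    have hm : (0 : ℝ) ≤ max 1 K := le_trans zero_le_one (le_max_left _ _)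
    rw [Real.coe_toNNReal _ hm, dist_eq_norm, dist_eq_norm, Prod.norm_def, Prod.norm_def]
    simp only [Prod.fst_sub, Prod.snd_sub]
    apply max_le
    · exact (le_max_right _ _).trans (le_mul_of_one_le_left (by positivity) (le_max_left _ _))
    · rw [← mul_sub, norm_mul]
      exact mul_le_mul ((hq t ⟨ht.1.le, ht.2⟩).trans (le_max_right _ _)) (le_max_left _ _)
        (norm_nonneg _) hm
  · exact fun y hy => ((hD y hy).continuousAt.prodMk (hD' y hy).continuousAt).continuousWithinAt
  · exact fun y hy => ((hD y ⟨hy.1.le, hy.2⟩).prodMk (hD' y ⟨hy.1.le, hy.2⟩)).hasDerivWithinAt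
  · intro t _
    simpa using! (hasDerivWithinAt_const t (Set.Iic t) (0 : ℂ × ℂ))

/-- A real function with a finite limit at infinity cannot have derivative eventually at least
one. -/
lemma false_of_tendsto_of_one_le_deriv {g g' : ℝ → ℝ} {l : ℝ} (hg : Tendsto g atTop (𝓝 l))
    (hd : ∀ᶠ y in atTop, HasDerivAt g (g' y) y) (h1 : ∀ᶠ y in atTop, 1 ≤ g' y) : False := by
  obtain ⟨Y, hY⟩ := eventually_atTop.1 (hd.and h1)
  have h0 : Tendsto (fun y => g (y + 1) - g y) atTop (𝓝 (l - l)) :=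
    (hg.comp (tendsto_atTop_add_const_right _ _ tendsto_id)).sub hg
  rw [sub_self] at h0
  obtain ⟨y, hy1, hy2⟩ := ((h0.eventually (gt_mem_nhds one_pos)).and (eventually_ge_atTop Y)).exists
  obtain ⟨z, hz, hz'⟩ := exists_hasDerivAt_eq_slope g g' (lt_add_one y)
    (fun x hx => (hY x (hy2.trans hx.1)).1.continuousAt.continuousWithinAt)
    (fun x hx => (hY x (hy2.trans hx.1.le)).1)
  have := (hY z (hy2.trans hz.1.le)).2
  rw [hz', add_sub_cancel_left, div_one] at this
  linarith

lemma ofReal_cpow_neg_intCast_mul_exp (k : ℤ) (y : ℝ) :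
    (y : ℂ) ^ (-(k : ℂ)) * Complex.exp ((y : ℂ) / 2) = ((y ^ (-k) * Real.exp (y / 2) : ℝ) : ℂ) := by
  rw [← Int.cast_neg, Complex.cpow_intCast]
  push_cast
  rfl

lemma tendsto_zpow_mul_exp_atTop (k : ℤ) {b : ℝ} (hb : 0 < b) :
    Tendsto (fun y : ℝ => y ^ k * Real.exp (b * y)) atTop atTop := by
  have := tendsto_exp_mul_div_rpow_atTop (-k : ℝ) b hb
  refine this.congr' ?_
  filter_upwards [eventually_gt_atTop 0] with y hy
  rw [← Int.cast_neg, Real.rpow_intCast, zpow_neg, div_inv_eq_mul, mul_comm]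

/-- Uniqueness of the Whittaker function on `(0, ∞)`. -/
theorem IsWhittakerW.eq_of_pos {k : ℤ} {μ : ℂ} {W₁ W₂ : ℝ → ℂ} (h₁ : IsWhittakerW k μ W₁)
    (h₂ : IsWhittakerW k μ W₂) {y₀ : ℝ} (hy₀ : 0 < y₀) : W₁ y₀ = W₂ y₀ := by
  set e : ℝ → ℝ := fun y => y ^ (-k) * Real.exp (y / 2) with he
  have as1 : Tendsto (fun y => (e y : ℂ) * W₁ y) atTop (𝓝 1) :=
    h₁.asymptotic.congr fun y => by rw [ofReal_cpow_neg_intCast_mul_exp]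
  have as2 : Tendsto (fun y => (e y : ℂ) * W₂ y) atTop (𝓝 1) :=
    h₂.asymptotic.congr fun y => by rw [ofReal_cpow_neg_intCast_mul_exp]
  have hepos : ∀ y : ℝ, 0 < y → 0 < e y := fun y hy => by positivity
  have hetop : Tendsto e atTop atTop := by
    refine (tendsto_zpow_mul_exp_atTop (-k) (b := 1 / 2) (by norm_num)).congr fun y => ?_
    simp only [he]; congr 2; ring
  have hW1 : ∀ᶠ y in atTop, W₁ y ≠ 0 :=
    (as1.eventually_ne one_ne_zero).mono fun y hy => right_ne_zero_of_mul hy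
  have hd1 := fun y hy => (h₁.differentiableAt y hy).hasDerivAt
  have hd2 := fun y hy => (h₂.differentiableAt y hy).hasDerivAt
  -- The Wronskian is a constant c, and (W₂ / W₁)' = c / W₁² grows exponentially unless c = 0, which
  -- the limit 1 of the ratio forbids.
  set w : ℝ → ℂ := fun y => W₁ y * deriv W₂ y - W₂ y * deriv W₁ y with hw
  have hwd : ∀ y, 0 < y → HasDerivAt w 0 y := fun y hy => by
    have := ((hd1 y hy).mul (h₂.equation y hy)).sub ((hd2 y hy).mul (h₁.equation y hy))
    convert! this using 1
    ring
  obtain ⟨c, hc⟩ : ∃ c, ∀ y, 0 < y → w y = c := by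
    refine ⟨w 1, fun y hy => ?_⟩
    exact (convex_Ioi (0 : ℝ)).is_const_of_fderivWithin_eq_zero (𝕜 := ℝ)
      (fun z hz => (hwd z hz).differentiableAt.differentiableWithinAt)
      (fun z hz => by
        rw [(hwd z hz).hasFDerivAt.hasFDerivWithinAt.fderivWithin
          (isOpen_Ioi.uniqueDiffWithinAt hz)]
        ext; simp) hy (Set.mem_Ioi.2 one_pos)
  have hratio : Tendsto (fun y => W₂ y / W₁ y) atTop (𝓝 1) := by
    have := as2.div as1 one_ne_zero
    rw [div_one] at this
    refine this.congr' ?_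
    filter_upwards [eventually_gt_atTop 0] with y hy
    exact mul_div_mul_left _ _ (by exact_mod_cast (hepos y hy).ne')
  have hdr : ∀ᶠ y in atTop, HasDerivAt (fun y => W₂ y / W₁ y) (c / W₁ y ^ 2) y := by
    filter_upwards [hW1, eventually_gt_atTop 0] with y hy hy0
    convert! (hd2 y hy0).div (hd1 y hy0) hy using 1
    rw [← hc y hy0]; simp only [hw]; ring
  have hc0 : c = 0 := by
    by_contra hne
    have h1 : Tendsto (fun y => (W₂ y / W₁ y / c).re) atTop (𝓝 (1 / c).re) :=
      (Complex.continuous_re.tendsto _).comp (hratio.div_const c)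
    refine false_of_tendsto_of_one_le_deriv (g' := fun y => (1 / W₁ y ^ 2).re) h1 ?_ ?_
    · filter_upwards [hdr] with y hy
      have := (Complex.reCLM.hasFDerivAt.comp_hasDerivAt y (hy.div_const c))
      convert! this using 1
      simp only [Complex.reCLM_apply]
      congr 1
      field_simp
    · have h2 : Tendsto (fun y => (1 / ((e y : ℂ) * W₁ y) ^ 2).re) atTop (𝓝 1) := by
        have := (Complex.continuous_re.tendsto _).comp
          ((tendsto_const_nhds (x := (1 : ℂ))).div (as1.pow 2) (by norm_num))
        rw [one_pow, div_one, Complex.one_re] at this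
        exact this
      filter_upwards [h2.eventually (lt_mem_nhds (by norm_num : (1 / 2 : ℝ) < 1)),
        hetop.eventually_ge_atTop 2, hW1] with y h3 h4 h5
      have h6 : 1 / W₁ y ^ 2 = ((e y ^ 2 : ℝ) : ℂ) * (1 / ((e y : ℂ) * W₁ y) ^ 2) := by
        have : (e y : ℂ) ≠ 0 := by
          have : e y ≠ 0 := by positivity
          exact_mod_cast this
        push_cast
        field_simp
      rw [h6, Complex.re_ofReal_mul]
      nlinarith
  subst hc0
  obtain ⟨Y, hY⟩ := eventually_atTop.1 ((hdr.and hW1).and (eventually_ge_atTop y₀))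
  have hconst : ∀ y ∈ Set.Ioi Y, W₂ y / W₁ y = 1 := fun y hy => by
    refine tendsto_nhds_unique (tendsto_const_nhds.congr' ?_) hratio
    filter_upwards [eventually_gt_atTop Y] with z hz
    have hd0 : ∀ x ∈ Set.Ioi Y, HasDerivAt (fun y => W₂ y / W₁ y) 0 x := fun x hx => by
      simpa using (hY x (le_of_lt hx)).1.1
    exact (convex_Ioi Y).is_const_of_fderivWithin_eq_zero (𝕜 := ℝ)
      (fun z hz => (hd0 z hz).differentiableAt.differentiableWithinAt)
      (fun z hz => by
        rw [(hd0 z hz).hasFDerivAt.hasFDerivWithinAt.fderivWithin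
          (isOpen_Ioi.uniqueDiffWithinAt hz)]
        ext; simp) hy hz
  have heq : ∀ y ∈ Set.Ioi Y, W₁ y = W₂ y := fun y hy =>
    ((div_eq_one_iff_eq (hY y (le_of_lt hy)).1.2).1 (hconst y hy)).symm
  have hYy : y₀ ≤ Y + 1 := (hY Y le_rfl).2.trans (by linarith)
  have hYmem : Y + 1 ∈ Set.Ioi Y := lt_add_one Y
  have hder : deriv W₁ (Y + 1) = deriv W₂ (Y + 1) := by
    apply Filter.EventuallyEq.deriv_eq
    filter_upwards [isOpen_Ioi.mem_nhds hYmem] with z hz using heq z hz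
  -- The solutions agree beyond Y, so they share Cauchy data at Y + 1; the coefficient of the
  -- equation is bounded on [y₀, Y + 1], which carries equality back to y₀.
  rw [← sub_eq_zero]
  refine eq_zero_of_hasDerivAt_of_eq_zero (D := fun y => W₁ y - W₂ y)
    (D' := fun y => deriv W₁ y - deriv W₂ y)
    (q := fun y => 1 / 4 - k / (y : ℂ) - (1 / 4 - μ ^ 2) / (y : ℂ) ^ 2)
    (K := 1 / 4 + ‖(k : ℂ)‖ / y₀ + ‖1 / 4 - μ ^ 2‖ / y₀ ^ 2) hYy ?_ ?_ ?_ ?_ ?_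
  · exact fun y hy => (hd1 y (hy₀.trans_le hy.1)).sub (hd2 y (hy₀.trans_le hy.1))
  · intro y hy
    convert! (h₁.equation y (hy₀.trans_le hy.1)).sub (h₂.equation y (hy₀.trans_le hy.1)) using 1
    ring
  · intro y hy
    have hy' : 0 < y := hy₀.trans_le hy.1
    refine (norm_sub_le _ _).trans (add_le_add ((norm_sub_le _ _).trans (add_le_add ?_ ?_)) ?_)
    · norm_num
    · rw [norm_div, Complex.norm_of_nonneg hy'.le]
      exact div_le_div_of_nonneg_left (norm_nonneg _) hy₀ hy.1
    · rw [norm_div, norm_pow, Complex.norm_of_nonneg hy'.le]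
      exact div_le_div_of_nonneg_left (norm_nonneg _) (by positivity)
        (pow_le_pow_left₀ hy₀.le hy.1 2)
  · simp [heq _ hYmem]
  · simp [hder]

/-! ### Growth bounds on the half-line -/

/-- `f` is bounded on `(0, ∞)` by a multiple of `y ^ (3 / 8) * (1 + y) ^ n * exp (-y / 4)` for
some `n`. -/
def WhittakerBound {E : Type*} [NormedAddCommGroup E] (f : ℝ → E) : Prop :=
  ∃ (C : ℝ) (n : ℕ), 0 ≤ C ∧ ∀ y : ℝ, 0 < y →
    ‖f y‖ ≤ C * (y ^ (3 / 8 : ℝ) * (1 + y) ^ n * Real.exp (-y / 4))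

namespace WhittakerBound

variable {E : Type*} [NormedAddCommGroup E] {𝕜 : Type*} [RCLike 𝕜]

lemma add {f g : ℝ → E} (hf : WhittakerBound f) (hg : WhittakerBound g) :
    WhittakerBound (fun y => f y + g y) := by
  obtain ⟨C, n, hC, h⟩ := hf
  obtain ⟨D, m, hD, h'⟩ := hg
  refine ⟨C + D, max n m, add_nonneg hC hD, fun y hy => (norm_add_le _ _).trans ?_⟩
  have h1 : (1 : ℝ) ≤ 1 + y := by linarith
  rw [add_mul]
  refine add_le_add ((h y hy).trans ?_) ((h' y hy).trans ?_)
  · gcongr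
    exact le_max_left _ _
  · gcongr
    exact le_max_right _ _

lemma const_mul {f : ℝ → 𝕜} (hf : WhittakerBound f) (c : 𝕜) :
    WhittakerBound (fun y => c * f y) := by
  obtain ⟨C, n, hC, h⟩ := hf
  refine ⟨‖c‖ * C, n, by positivity, fun y hy => ?_⟩
  rw [norm_mul, mul_assoc]
  exact mul_le_mul_of_nonneg_left (h y hy) (norm_nonneg _)

lemma sub {f g : ℝ → 𝕜} (hf : WhittakerBound f) (hg : WhittakerBound g) :
    WhittakerBound (fun y => f y - g y) := by
  simpa [sub_eq_add_neg] using hf.add (hg.const_mul (-1))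

lemma ofReal_mul {f : ℝ → 𝕜} (hf : WhittakerBound f) :
    WhittakerBound (fun y => (y : 𝕜) * f y) := by
  obtain ⟨C, n, hC, h⟩ := hf
  refine ⟨C, n + 1, hC, fun y hy => ?_⟩
  rw [norm_mul, RCLike.norm_ofReal, abs_of_pos hy]
  calc y * ‖f y‖ ≤ (1 + y) * (C * (y ^ (3 / 8 : ℝ) * (1 + y) ^ n * Real.exp (-y / 4))) :=
        mul_le_mul (by linarith) (h y hy) (norm_nonneg _) (by linarith)
    _ = _ := by ring

lemma congr {f g : ℝ → E} (hf : WhittakerBound f) (h : ∀ y, 0 < y → g y = f y) :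
    WhittakerBound g := by
  obtain ⟨C, n, hC, hb⟩ := hf
  exact ⟨C, n, hC, fun y hy => by rw [h y hy]; exact hb y hy⟩

lemma ofReal {f : ℝ → ℝ} (hf : WhittakerBound f) : WhittakerBound (fun y => (f y : ℂ)) := by
  obtain ⟨C, n, hC, hb⟩ := hf
  exact ⟨C, n, hC, fun y hy => by rw [Complex.norm_real]; exact hb y hy⟩

end WhittakerBound

lemma tendsto_rpow_mul_one_add_pow_mul_exp_neg (a : ℝ) (n : ℕ) {b : ℝ} (hb : 0 < b) :
    Tendsto (fun y : ℝ => y ^ a * (1 + y) ^ n * Real.exp (-b * y)) atTop (𝓝 0) := by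
  have h1 := (tendsto_rpow_mul_exp_neg_mul_atTop_nhds_zero (a + n) b hb).const_mul (2 ^ n)
  rw [mul_zero] at h1
  refine squeeze_zero' ?_ ?_ h1
  · filter_upwards [eventually_gt_atTop 0] with y hy
    positivity
  · filter_upwards [eventually_ge_atTop 1] with y hy
    have hy0 : 0 < y := by linarith
    rw [Real.rpow_add hy0, Real.rpow_natCast]
    calc y ^ a * (1 + y) ^ n * Real.exp (-b * y)
        ≤ y ^ a * (2 * y) ^ n * Real.exp (-b * y) := by gcongr; linarith
      _ = _ := by rw [mul_pow]; ring

lemma WhittakerBound.tendsto_zero {f : ℝ → ℝ} (hf : WhittakerBound f) (k : ℤ) :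
    Tendsto (fun y => f y * (y ^ k * Real.exp (-y / 2))) atTop (𝓝 0) := by
  obtain ⟨C, n, hC, hb⟩ := hf
  have h1 := (tendsto_rpow_mul_one_add_pow_mul_exp_neg (3 / 8 + k) n
    (b := 3 / 4) (by norm_num)).const_mul C
  rw [mul_zero] at h1
  refine squeeze_zero_norm' ?_ h1
  filter_upwards [eventually_gt_atTop 0] with y hy
  rw [norm_mul, Real.norm_of_nonneg (by positivity : 0 ≤ y ^ k * Real.exp (-y / 2)),
    Real.rpow_add hy, Real.rpow_intCast]
  calc _ ≤ _ := mul_le_mul_of_nonneg_right (hb y hy) (by positivity)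
    _ = C * (y ^ (3 / 8 : ℝ) * y ^ k * (1 + y) ^ n * (Real.exp (-y / 4) * Real.exp (-y / 2))) := by
      ring
    _ = _ := by rw [← Real.exp_add]; congr 3; ring

/-! ### Real Whittaker functions and ladder operators -/

/-- The real-valued Whittaker function `w = W_{k,ir}` for integral `k`, with derivative `w'`, its
asymptotic behaviour at infinity and a bound on all of `(0, ∞)`. -/
structure IsRealWhittaker (r : ℝ) (k : ℤ) (w w' : ℝ → ℝ) : Prop where
  hasDerivAt : ∀ y, 0 < y → HasDerivAt w (w' y) y
  hasDerivAt_deriv : ∀ y, 0 < y →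
    HasDerivAt w' ((1 / 4 - k / y - (1 / 4 + r ^ 2) / y ^ 2) * w y) y
  tendsto : Tendsto (fun y => y ^ (-k) * Real.exp (y / 2) * w y) atTop (𝓝 1)
  tendsto_deriv : Tendsto (fun y => y ^ (-k) * Real.exp (y / 2) * w' y) atTop (𝓝 (-1 / 2))
  bound : WhittakerBound w
  bound_deriv : WhittakerBound (fun y => y * w' y)

namespace IsRealWhittaker

variable {r : ℝ} {k : ℤ} {w w' : ℝ → ℝ}

/-- The raising operator is a first-order factor of Whittaker's equation. At infinity (y/2) w and -y
w' reinforce each other, so both limits follow termwise from those of w and w'. -/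
theorem raise (h : IsRealWhittaker r k w w') :
    IsRealWhittaker r (k + 1) (fun y => (y / 2 - k) * w y - y * w' y)
      (fun y => ((k + 1 - y / 2) * ((y / 2 - k) * w y - y * w' y) +
        (r ^ 2 + (k + 1 / 2) ^ 2) * w y) / y) := by
  have hinv : Tendsto (fun y : ℝ => y⁻¹) atTop (𝓝 0) := tendsto_inv_atTop_zero
  have hd : ∀ y, 0 < y → HasDerivAt (fun y => (y / 2 - k) * w y - y * w' y)
      (((k + 1 - y / 2) * ((y / 2 - k) * w y - y * w' y) +
        (r ^ 2 + (k + 1 / 2) ^ 2) * w y) / y) y := fun y hy => by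
    have := ((((hasDerivAt_id y).div_const 2).sub_const (k : ℝ)).mul (h.hasDerivAt y hy)).sub
      ((hasDerivAt_id y).mul (h.hasDerivAt_deriv y hy))
    convert! this using 1
    simp only [id]
    field_simp
    ring
  have ht : Tendsto (fun y => y ^ (-(k + 1)) * Real.exp (y / 2) *
      ((y / 2 - k) * w y - y * w' y)) atTop (𝓝 1) := by
    have := (((tendsto_const_nhds (x := (1 / 2 : ℝ))).sub (hinv.const_mul (k : ℝ))).mul
      h.tendsto).sub h.tendsto_deriv
    convert this.congr' ?_ using 2
    · norm_num
    · filter_upwards [eventually_gt_atTop 0] with y hy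
      rw [neg_add, zpow_add₀ hy.ne', zpow_neg_one]
      field_simp
  have hb : WhittakerBound (fun y => (y / 2 - k) * w y - y * w' y) :=
    (((h.bound.ofReal_mul.const_mul (1 / 2)).sub (h.bound.const_mul (k : ℝ))).sub
      h.bound_deriv).congr fun y _ => by simp; ring
  refine ⟨hd, fun y hy => ?_, ht, ?_, hb, ?_⟩
  · have := (((((hasDerivAt_id y).div_const 2).const_sub (k + 1 : ℝ)).mul (hd y hy)).add
      ((h.hasDerivAt y hy).const_mul (r ^ 2 + (k + 1 / 2 : ℝ) ^ 2))).div (hasDerivAt_id y) hy.ne'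
    convert! this using 1
    simp only [id, Pi.add_apply, Pi.mul_apply]
    push_cast
    field_simp
    ring
  · have := (((hinv.const_mul (k + 1 : ℝ)).sub (tendsto_const_nhds (x := (1 / 2 : ℝ)))).mul
      ht).add (((hinv.pow 2).const_mul (r ^ 2 + (k + 1 / 2 : ℝ) ^ 2)).mul h.tendsto)
    convert this.congr' ?_ using 2
    · norm_num
    · filter_upwards [eventually_gt_atTop 0] with y hy
      rw [neg_add, zpow_add₀ hy.ne', zpow_neg_one]
      field_simp
  · refine (((hb.const_mul (k + 1 : ℝ)).sub (hb.ofReal_mul.const_mul (1 / 2))).add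
      (h.bound.const_mul (r ^ 2 + (k + 1 / 2 : ℝ) ^ 2))).congr fun y hy => ?_
    simp only [RCLike.ofReal_real_eq_id, id]
    field_simp

/-- This is the constant by which the lowering operator must be divided. -/
lemma sq_add_sq_ne_zero (r : ℝ) (k : ℤ) : r ^ 2 + (k - 1 / 2 : ℝ) ^ 2 ≠ 0 := by
  have : (k - 1 / 2 : ℝ) ≠ 0 := by
    intro h
    have h2 : (2 * k : ℝ) = 1 := by linarith
    have : 2 * k = 1 := by exact_mod_cast h2
    omega
  positivity

/-- Lowering inverts raising up to the constant c. Here the leading terms of y w' and (y/2) w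
cancel, so the asymptotics of v cannot be read off termwise. L'Hôpital's rule is applied to v
y^{k-1} e^{-y/2} over y^{2k-2} e^{-y}: both tend to 0, and the derivative of the numerator involves
only w. -/
theorem lower (h : IsRealWhittaker r k w w') :
    ∃ v v', IsRealWhittaker r (k - 1) v v' := by
  set c : ℝ := r ^ 2 + (k - 1 / 2 : ℝ) ^ 2 with hc
  have hc0 : c ≠ 0 := sq_add_sq_ne_zero r k
  set v : ℝ → ℝ := fun y => (y * w' y - (k - y / 2) * w y) / c with hv
  set v' : ℝ → ℝ := fun y => ((y / 2 - (k - 1)) * v y - w y) / y with hv'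
  have hinv : Tendsto (fun y : ℝ => y⁻¹) atTop (𝓝 0) := tendsto_inv_atTop_zero
  have hd : ∀ y, 0 < y → HasDerivAt v (v' y) y := fun y hy => by
    have := (((hasDerivAt_id y).mul (h.hasDerivAt_deriv y hy)).sub
      ((((hasDerivAt_id y).div_const 2).const_sub (k : ℝ)).mul (h.hasDerivAt y hy))).div_const c
    convert! this using 1
    simp only [id, hv', hv]
    field_simp
    rw [hc]
    ring
  have hb : WhittakerBound v :=
    ((h.bound_deriv.sub ((h.bound.const_mul (k : ℝ)).sub
      (h.bound.ofReal_mul.const_mul (1 / 2)))).const_mul c⁻¹).congr fun y _ => by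
        simp only [hv, RCLike.ofReal_real_eq_id, id]; field_simp
  have ht : Tendsto (fun y => y ^ (-(k - 1)) * Real.exp (y / 2) * v y) atTop (𝓝 1) := by
    have hexp : ∀ y : ℝ, HasDerivAt (fun y => Real.exp (-y / 2)) (Real.exp (-y / 2) * (-1 / 2)) y :=
      fun y => ((hasDerivAt_id y).neg.div_const 2).exp
    have hf : ∀ y : ℝ, 0 < y → HasDerivAt (fun y => v y * (y ^ (k - 1) * Real.exp (-y / 2)))
        (-(w y * (y ^ (k - 2) * Real.exp (-y / 2)))) y := fun y hy => by
      have := (hd y hy).mul ((hasDerivAt_zpow (k - 1) y (Or.inl hy.ne')).mul (hexp y))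
      convert! this using 1
      have e1 : y ^ (k - 1) = y ^ (k - 2) * y := by
        rw [← zpow_add_one₀ hy.ne']; congr 1; ring
      have e2 : y ^ (k - 1 - 1) = y ^ (k - 2) := by congr 1; ring
      simp only [Pi.mul_apply, hv', e1, e2]
      push_cast
      field_simp
      ring
    have hg : ∀ y : ℝ, 0 < y → HasDerivAt (fun y => y ^ (2 * k - 2) * Real.exp (-y))
        (((2 * k - 2) / y - 1) * (y ^ (2 * k - 2) * Real.exp (-y))) y := fun y hy => by
      have := (hasDerivAt_zpow (2 * k - 2) y (Or.inl hy.ne')).mul (hasDerivAt_neg y).exp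
      convert! this using 1
      rw [zpow_sub_one₀ hy.ne']
      push_cast
      field_simp
      ring
    have hlim : Tendsto (fun y : ℝ => (2 * k - 2 : ℝ) / y - 1) atTop (𝓝 (-1)) := by
      have := (hinv.const_mul (2 * k - 2 : ℝ)).sub_const 1
      simpa [div_eq_mul_inv] using this
    have key := HasDerivAt.lhopital_zero_atTop (l := 𝓝 1)
      ((eventually_gt_atTop 0).mono fun y hy => hf y hy)
      ((eventually_gt_atTop 0).mono fun y hy => hg y hy) ?_ (hb.tendsto_zero (k - 1)) ?_ ?_
    · refine key.congr' ?_
      filter_upwards [eventually_gt_atTop 0] with y hy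
      have e1 : y ^ (2 * k - 2) = y ^ (k - 1) * y ^ (k - 1) := by
        rw [← zpow_add₀ hy.ne']; congr 1; ring
      have e2 : Real.exp (-y) = Real.exp (-y / 2) * Real.exp (-y / 2) := by
        rw [← Real.exp_add]; congr 1; ring
      have e3 : Real.exp (y / 2) = (Real.exp (-y / 2))⁻¹ := by
        rw [← Real.exp_neg]; congr 1; ring
      rw [e1, e2, e3, zpow_neg]
      field_simp
    · filter_upwards [hlim.eventually_ne (by norm_num : (-1 : ℝ) ≠ 0), eventually_gt_atTop 0]
        with y h1 hy
      exact mul_ne_zero h1 (by positivity)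
    · have := tendsto_rpow_mul_exp_neg_mul_atTop_nhds_zero (2 * k - 2) 1 one_pos
      refine this.congr' ?_
      filter_upwards [eventually_gt_atTop 0] with y hy
      rw [neg_one_mul]
      congr 1
      exact_mod_cast Real.rpow_intCast y (2 * k - 2)
    · have h1 := (h.tendsto.div hlim (by norm_num)).neg
      have h2 : -(1 / -1 : ℝ) = 1 := by norm_num
      rw [h2] at h1
      refine h1.congr' ?_
      filter_upwards [eventually_gt_atTop 0, hlim.eventually_ne (by norm_num : (-1 : ℝ) ≠ 0)]
        with y hy h1
      have e1 : y ^ (2 * k - 2) = y ^ (k - 2) * y ^ k := by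
        rw [← zpow_add₀ hy.ne']; congr 1; ring
      have e2 : Real.exp (-y) = Real.exp (-y / 2) * Real.exp (-y / 2) := by
        rw [← Real.exp_add]; congr 1; ring
      have e3 : Real.exp (y / 2) = (Real.exp (-y / 2))⁻¹ := by
        rw [← Real.exp_neg]; congr 1; ring
      rw [Pi.div_apply, e1, e2, e3, zpow_neg]
      field_simp
  refine ⟨v, v', hd, fun y hy => ?_, ht, ?_, hb, ?_⟩
  · have := (((((hasDerivAt_id y).div_const 2).sub_const (k - 1 : ℝ)).mul (hd y hy)).sub
      (h.hasDerivAt y hy)).div (hasDerivAt_id y) hy.ne'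
    convert! this using 1
    have hw : w' y = (c * v y + (k - y / 2) * w y) / y := by
      simp only [hv]; field_simp; ring
    simp only [id, Pi.sub_apply, Pi.mul_apply, hv', hw]
    push_cast
    field_simp
    rw [hc]
    ring
  · have := (((tendsto_const_nhds (x := (1 / 2 : ℝ))).sub (hinv.const_mul (k - 1 : ℝ))).mul
      ht).sub h.tendsto
    convert this.congr' ?_ using 2
    · norm_num
    · filter_upwards [eventually_gt_atTop 0] with y hy
      have e1 : y ^ (-(k - 1)) = y ^ (-k) * y := by
        rw [← zpow_add_one₀ hy.ne']; congr 1; ring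
      simp only [hv', e1]
      field_simp
  · refine (((hb.ofReal_mul.const_mul (1 / 2)).sub (hb.const_mul (k - 1 : ℝ))).sub
      h.bound).congr fun y hy => ?_
    simp only [RCLike.ofReal_real_eq_id, id, hv']
    field_simp

theorem exists_of_zero (h : ∃ w w', IsRealWhittaker r 0 w w') (k : ℤ) :
    ∃ w w', IsRealWhittaker r k w w' := by
  induction k using Int.induction_on with
  | zero => exact h
  | succ i ih =>
    obtain ⟨w, w', hw⟩ := ih
    exact ⟨_, _, hw.raise⟩
  | pred i ih =>
    obtain ⟨w, w', hw⟩ := ih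
    exact hw.lower

/-- Only μ² enters the equation, so the same real function serves μ = ir and μ = -ir; the integral
uses both signs. -/
theorem isWhittakerW (h : IsRealWhittaker r k w w') {μ : ℂ} (hμ : μ ^ 2 = -r ^ 2) :
    IsWhittakerW k μ (fun y => (w y : ℂ)) := by
  have hd : ∀ y, 0 < y → HasDerivAt (fun y => (w y : ℂ)) (w' y : ℂ) y :=
    fun y hy => (h.hasDerivAt y hy).ofReal_comp
  refine ⟨fun y hy => (hd y hy).differentiableAt, fun y hy => ?_, ?_⟩
  · have h1 := (h.hasDerivAt_deriv y hy).ofReal_comp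
    have h2 : deriv (fun y => (w y : ℂ)) =ᶠ[𝓝 y] fun y => (w' y : ℂ) := by
      filter_upwards [isOpen_Ioi.mem_nhds (Set.mem_Ioi.2 hy)] with z hz using (hd z hz).deriv
    refine (h1.congr_of_eventuallyEq h2).congr_deriv ?_
    rw [hμ]
    push_cast
    ring
  · have := (Complex.continuous_ofReal.tendsto 1).comp h.tendsto
    refine this.congr fun y => ?_
    rw [ofReal_cpow_neg_intCast_mul_exp]
    simp

end IsRealWhittaker

/-! ### The Bessel integral and the case k = 0 -/

lemma integrable_exp_neg_mul_abs {σ : ℝ} (hσ : 0 < σ) :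
    Integrable (fun u : ℝ => Real.exp (-σ * |u|)) := by
  rw [← integrableOn_univ, ← Set.Iic_union_Ioi (a := (0 : ℝ))]
  refine IntegrableOn.union ?_ ?_
  · refine (integrableOn_exp_mul_Iic hσ 0).congr_fun (fun u hu => ?_) measurableSet_Iic
    simp [abs_of_nonpos (Set.mem_Iic.1 hu)]
  · refine (integrableOn_exp_mul_Ioi (neg_neg_of_pos hσ) 0).congr_fun (fun u hu => ?_)
      measurableSet_Ioi
    simp [abs_of_pos (Set.mem_Ioi.1 hu)]

lemma exp_abs_le_two_mul_cosh (u : ℝ) : Real.exp |u| ≤ 2 * Real.cosh u := by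
  rw [← Real.cosh_abs, Real.cosh_eq]
  linarith [Real.exp_pos (-|u|)]

lemma cosh_le_exp_abs (u : ℝ) : Real.cosh u ≤ Real.exp |u| := by
  rw [← Real.cosh_abs, Real.cosh_eq]
  linarith [Real.exp_le_exp.2 (by linarith [abs_nonneg u] : -|u| ≤ |u|)]

lemma continuous_cosh_rpow (σ : ℝ) : Continuous (fun u : ℝ => Real.cosh u ^ σ) :=
  Real.continuous_cosh.rpow_const fun u => Or.inl (Real.cosh_pos u).ne'

lemma integrable_cosh_rpow_neg {σ : ℝ} (hσ : 0 < σ) :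
    Integrable (fun u : ℝ => Real.cosh u ^ (-σ)) := by
  refine ((integrable_exp_neg_mul_abs hσ).const_mul (2 ^ σ)).mono'
    (continuous_cosh_rpow _).aestronglyMeasurable (Eventually.of_forall fun u => ?_)
  have hc := Real.cosh_pos u
  rw [Real.norm_of_nonneg (by positivity)]
  have h1 : (2 * Real.cosh u) ^ (-σ) ≤ Real.exp |u| ^ (-σ) :=
    Real.rpow_le_rpow_of_nonpos (Real.exp_pos _) (exp_abs_le_two_mul_cosh u) (by linarith)
  rw [Real.mul_rpow two_pos.le hc.le, ← Real.exp_mul, Real.rpow_neg two_pos.le,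
    inv_mul_le_iff₀ (by positivity)] at h1
  exact h1.trans_eq (by ring_nf)

lemma exists_rpow_mul_exp_le {b : ℝ} (hb : 0 < b) :
    ∃ C : ℝ, 0 ≤ C ∧ ∀ x : ℝ, 0 < x → x ^ b * Real.exp (-x / 4) ≤ C := by
  -- From u ≤ exp u at u = x/(4b): its b-th power has right side exp(x/4).
  refine ⟨(4 * b) ^ b, by positivity, fun x hx => ?_⟩
  have h1 : (x / (4 * b)) ^ b ≤ Real.exp (x / (4 * b)) ^ b :=
    Real.rpow_le_rpow (by positivity) (by linarith [Real.add_one_le_exp (x / (4 * b))]) hb.le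
  rw [← Real.exp_mul, Real.div_rpow hx.le (by positivity), div_le_iff₀ (by positivity)] at h1
  calc x ^ b * Real.exp (-x / 4)
      ≤ Real.exp (x / (4 * b) * b) * (4 * b) ^ b * Real.exp (-x / 4) := by gcongr
    _ = (4 * b) ^ b * (Real.exp (x / (4 * b) * b) * Real.exp (-x / 4)) := by ring
    _ = (4 * b) ^ b := by
      rw [← Real.exp_add, show x / (4 * b) * b + -x / 4 = 0 by field_simp; ring, Real.exp_zero,
        mul_one]

/-- Half of the exponential controls powers of y cosh u, and half keeps the decay e^{-y/4} because
cosh u ≥ 1. The extra 1/8 buys integrability in u at the price of y^{-1/8}; after the factor √y of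
W_{0,ir} this leaves the exponent 3/8 of `WhittakerBound`. -/
lemma exists_cosh_pow_mul_exp_le (j : ℕ) : ∃ C : ℝ, 0 ≤ C ∧ ∀ y u : ℝ, 0 < y →
    Real.cosh u ^ j * Real.exp (-(y / 2) * Real.cosh u) ≤
      C * (y ^ (-(j + 1 / 8) : ℝ) * Real.exp (-y / 4)) * Real.cosh u ^ (-(1 / 8) : ℝ) := by
  obtain ⟨C, hC, h⟩ := exists_rpow_mul_exp_le (b := j + 1 / 8) (by positivity)
  refine ⟨C, hC, fun y u hy => ?_⟩
  have hc := Real.cosh_pos u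
  have h1 := h (y * Real.cosh u) (by positivity)
  have h2 : Real.exp (-(y / 2) * Real.cosh u) ≤
      Real.exp (-(y * Real.cosh u) / 4) * Real.exp (-y / 4) := by
    rw [← Real.exp_add]
    apply Real.exp_le_exp.2
    nlinarith [Real.one_le_cosh u]
  have h3 : Real.cosh u ^ j = (y * Real.cosh u) ^ (j + 1 / 8 : ℝ) * y ^ (-(j + 1 / 8) : ℝ) *
      Real.cosh u ^ (-(1 / 8) : ℝ) := by
    rw [Real.mul_rpow hy.le hc.le, Real.rpow_add hc, Real.rpow_natCast, Real.rpow_neg hy.le,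
      Real.rpow_neg hc.le]
    field_simp
  calc Real.cosh u ^ j * Real.exp (-(y / 2) * Real.cosh u)
      ≤ Real.cosh u ^ j * (Real.exp (-(y * Real.cosh u) / 4) * Real.exp (-y / 4)) := by gcongr
    _ = ((y * Real.cosh u) ^ (j + 1 / 8 : ℝ) * Real.exp (-(y * Real.cosh u) / 4)) *
        (y ^ (-(j + 1 / 8) : ℝ) * Real.exp (-y / 4) * Real.cosh u ^ (-(1 / 8) : ℝ)) := by
      rw [h3]; ring
    _ ≤ C * (y ^ (-(j + 1 / 8) : ℝ) * Real.exp (-y / 4) * Real.cosh u ^ (-(1 / 8) : ℝ)) := by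
      gcongr
    _ = _ := by ring

lemma integrable_cosh_pow_mul_exp_mul (j : ℕ) {y : ℝ} (hy : 0 < y) {g : ℝ → ℝ}
    (hg : Continuous g) (hg1 : ∀ u, |g u| ≤ 1) :
    Integrable (fun u => Real.cosh u ^ j * Real.exp (-(y / 2) * Real.cosh u) * g u) := by
  obtain ⟨C, hC, h⟩ := exists_cosh_pow_mul_exp_le j
  refine ((integrable_cosh_rpow_neg (σ := 1 / 8) (by norm_num)).const_mul
    (C * (y ^ (-(j + 1 / 8) : ℝ) * Real.exp (-y / 4)))).mono'
    (by fun_prop) (Eventually.of_forall fun u => ?_)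
  rw [norm_mul, Real.norm_of_nonneg (by have := Real.cosh_pos u; positivity)]
  exact (mul_le_of_le_one_right (by have := Real.cosh_pos u; positivity) (hg1 u)).trans (h y u hy)

/-- The integrals `∫ cosh(u) ^ j * exp (-(y / 2) * cosh u) * cos (r * u) du`, which for `j = 0` are
`2 * K_{ir}(y / 2)`. -/
noncomputable def coshIntegral (r : ℝ) (j : ℕ) (y : ℝ) : ℝ :=
  ∫ u : ℝ, Real.cosh u ^ j * Real.exp (-(y / 2) * Real.cosh u) * Real.cos (r * u)

lemma exists_abs_coshIntegral_le (r : ℝ) (j : ℕ) : ∃ C : ℝ, 0 ≤ C ∧ ∀ y : ℝ, 0 < y →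
    |coshIntegral r j y| ≤ C * (y ^ (-(j + 1 / 8) : ℝ) * Real.exp (-y / 4)) := by
  obtain ⟨C, hC, h⟩ := exists_cosh_pow_mul_exp_le j
  have hint := integrable_cosh_rpow_neg (σ := 1 / 8) (by norm_num)
  refine ⟨C * ∫ u : ℝ, Real.cosh u ^ (-(1 / 8) : ℝ), mul_nonneg hC (integral_nonneg fun u =>
    Real.rpow_nonneg (Real.cosh_pos u).le _), fun y hy => ?_⟩
  rw [coshIntegral, ← Real.norm_eq_abs]
  refine (norm_integral_le_of_norm_le (hint.const_mul
    (C * (y ^ (-(j + 1 / 8) : ℝ) * Real.exp (-y / 4)))) (Eventually.of_forall fun u => ?_)).trans_eq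
    ?_
  · rw [norm_mul, Real.norm_of_nonneg (by have := Real.cosh_pos u; positivity)]
    exact (mul_le_of_le_one_right (by have := Real.cosh_pos u; positivity)
      (Real.abs_cos_le_one _)).trans (h y u hy)
  · rw [integral_const_mul]; ring

lemma hasDerivAt_coshIntegral (r : ℝ) (j : ℕ) {y : ℝ} (hy : 0 < y) :
    HasDerivAt (coshIntegral r j) (-(1 / 2) * coshIntegral r (j + 1) y) y := by
  obtain ⟨C, hC, h⟩ := exists_cosh_pow_mul_exp_le (j + 1)
  have key := hasDerivAt_integral_of_dominated_loc_of_deriv_le (μ := volume) (𝕜 := ℝ)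
    (F := fun y u => Real.cosh u ^ j * Real.exp (-(y / 2) * Real.cosh u) * Real.cos (r * u))
    (F' := fun y u => -(1 / 2) * (Real.cosh u ^ (j + 1) * Real.exp (-(y / 2) * Real.cosh u) *
      Real.cos (r * u)))
    (bound := fun u => C * ((y / 2) ^ (-((j + 1 : ℕ) + 1 / 8) : ℝ) * 1) *
      Real.cosh u ^ (-(1 / 8) : ℝ))
    -- Staying above y/2 keeps the negative power of x bounded, so one dominating function works for
    -- all x in this neighbourhood.
    (x₀ := y) (s := Set.Ioi (y / 2)) (Ioi_mem_nhds (by linarith))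
    (Eventually.of_forall fun x => by fun_prop)
    (integrable_cosh_pow_mul_exp_mul j hy (by fun_prop) fun u => Real.abs_cos_le_one _)
    (by fun_prop) (Eventually.of_forall fun u x hx => ?_)
    ((integrable_cosh_rpow_neg (σ := 1 / 8) (by norm_num)).const_mul _)
    (Eventually.of_forall fun u x hx => ?_)
  · rw [integral_const_mul] at key
    exact key.2
  · have hx' : y / 2 < x := hx
    have hx0 : 0 < x := by linarith
    have hcu := Real.cosh_pos u
    rw [norm_mul, norm_mul, Real.norm_of_nonneg (by positivity :
      0 ≤ Real.cosh u ^ (j + 1) * Real.exp (-(x / 2) * Real.cosh u))]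
    have h1 : ‖(-(1 / 2) : ℝ)‖ ≤ 1 := by norm_num
    calc _ ≤ 1 * (Real.cosh u ^ (j + 1) * Real.exp (-(x / 2) * Real.cosh u) * 1) := by
          gcongr
          exact Real.abs_cos_le_one _
      _ ≤ C * (x ^ (-((j + 1 : ℕ) + 1 / 8) : ℝ) * Real.exp (-x / 4)) *
          Real.cosh u ^ (-(1 / 8) : ℝ) := by
        rw [one_mul, mul_one]; exact h x u hx0
      _ ≤ _ := by
        gcongr C * (?_ * ?_) * _
        · exact Real.rpow_le_rpow_of_nonpos (by positivity) hx'.le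
            (by rw [neg_nonpos]; positivity)
        · exact Real.exp_le_one_iff.2 (by linarith)
  · have := ((((hasDerivAt_id x).div_const 2).neg.mul_const (Real.cosh u)).exp.const_mul
      (Real.cosh u ^ j)).mul_const (Real.cos (r * u))
    convert! this using 1
    simp only [id, Pi.neg_apply]
    ring

/-- The modified Bessel equation for `coshIntegral r 0`. -/
lemma coshIntegral_two (r : ℝ) {y : ℝ} (hy : 0 < y) :
    y ^ 2 / 4 * coshIntegral r 2 y =
      y / 2 * coshIntegral r 1 y + (y ^ 2 / 4 - r ^ 2) * coshIntegral r 0 y := by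
  have hi := fun j => integrable_cosh_pow_mul_exp_mul j hy (g := fun u => Real.cos (r * u))
    (by fun_prop) fun u => Real.abs_cos_le_one _
  have hs := integrable_cosh_pow_mul_exp_mul 0 hy (g := fun u => Real.sin (r * u))
    (by fun_prop) fun u => Real.abs_sin_le_one _
  -- The term with sinh u is written as cosh u times sinh u / cosh u, a factor bounded by 1.
  have ht := integrable_cosh_pow_mul_exp_mul 1 hy
    (g := fun u => Real.sinh u / Real.cosh u * Real.cos (r * u))
    (by
      have : ∀ u : ℝ, Real.cosh u ≠ 0 := fun u => (Real.cosh_pos u).ne'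
      fun_prop (disch := assumption)) fun u => by
      rw [abs_mul, abs_div, abs_of_pos (Real.cosh_pos u)]
      refine mul_le_one₀ ((div_le_one (Real.cosh_pos u)).2 ?_) (abs_nonneg _)
        (Real.abs_cos_le_one _)
      exact abs_le_of_sq_le_sq (by nlinarith [Real.cosh_sq u]) (Real.cosh_pos u).le
  -- Green's identity: with E = exp(-(y/2) cosh u), the function is E' cos(ru) - E (cos(ru))', whose
  -- derivative is (E'' + r² E) cos(ru).
  have hd := integral_eq_zero_of_hasDerivAt_of_integrable
    (f := fun u => Real.exp (-(y / 2) * Real.cosh u) *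
      (-(y / 2) * Real.sinh u * Real.cos (r * u) + r * Real.sin (r * u)))
    (f' := fun u =>
      y ^ 2 / 4 * (Real.cosh u ^ 2 * Real.exp (-(y / 2) * Real.cosh u) * Real.cos (r * u)) -
      y / 2 * (Real.cosh u ^ 1 * Real.exp (-(y / 2) * Real.cosh u) * Real.cos (r * u)) -
      (y ^ 2 / 4 - r ^ 2) *
        (Real.cosh u ^ 0 * Real.exp (-(y / 2) * Real.cosh u) * Real.cos (r * u)))
    (fun u => ?_)
    ((((hi 2).const_mul _).sub ((hi 1).const_mul _)).sub ((hi 0).const_mul _)) ?_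
  · have hi21 : Integrable (fun u =>
        y ^ 2 / 4 * (Real.cosh u ^ 2 * Real.exp (-(y / 2) * Real.cosh u) * Real.cos (r * u)) -
        y / 2 * (Real.cosh u ^ 1 * Real.exp (-(y / 2) * Real.cosh u) * Real.cos (r * u))) :=
      ((hi 2).const_mul _).sub ((hi 1).const_mul _)
    rw [integral_sub hi21 ((hi 0).const_mul _),
      integral_sub ((hi 2).const_mul _) ((hi 1).const_mul _), integral_const_mul,
      integral_const_mul, integral_const_mul] at hd
    simp only [coshIntegral]
    linarith
  · have h1 := ((Real.hasDerivAt_cosh u).const_mul (-(y / 2))).exp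
    have hru : HasDerivAt (fun u => r * u) r u := by
      simpa using (hasDerivAt_id u).const_mul r
    have h2 := (((Real.hasDerivAt_sinh u).const_mul (-(y / 2))).mul hru.cos).add
      (hru.sin.const_mul r)
    convert! h1.mul h2 using 1
    simp only [Pi.add_apply, Pi.mul_apply]
    have := Real.cosh_sq u
    linear_combination (y ^ 2 / 4 * Real.exp (-(y / 2) * Real.cosh u) * Real.cos (r * u)) * this
  · refine ((ht.const_mul (-(y / 2))).add (hs.const_mul r)).congr
      (Eventually.of_forall fun u => ?_)
    have := (Real.cosh_pos u).ne'
    simp only [Pi.add_apply]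
    field_simp

/-- Laplace's method. Since cosh u - 1 = 2 sinh²(u/2), the substitution u = v/√y turns the integrand
into one converging to the Gaussian exp(-v²/4), and sinh x ≥ x for x ≥ 0 supplies the domination. -/
lemma tendsto_sqrt_mul_exp_mul_coshIntegral (r : ℝ) (j : ℕ) :
    Tendsto (fun y => √y * Real.exp (y / 2) * coshIntegral r j y) atTop
      (𝓝 (2 * √Real.pi)) := by
  have hgauss : ∫ v : ℝ, Real.exp (-(1 / 4) * v ^ 2) = 2 * √Real.pi := by
    rw [integral_gaussian, div_div_eq_mul_div, div_one, Real.sqrt_mul Real.pi_pos.le,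
      show (4 : ℝ) = 2 ^ 2 by norm_num, Real.sqrt_sq two_pos.le, mul_comm]
  have hcosh : ∀ x : ℝ, Real.cosh x = 1 + 2 * Real.sinh (x / 2) ^ 2 := fun x => by
    have h1 := Real.cosh_two_mul (x / 2)
    have h2 := Real.cosh_sq (x / 2)
    rw [mul_div_cancel₀ _ (two_ne_zero)] at h1
    linarith
  rw [← hgauss]
  have h := tendsto_integral_filter_of_dominated_convergence (μ := volume) (l := atTop)
    (F := fun (y : ℝ) v => Real.cosh (v / √y) ^ j *
      Real.exp (-(√y * Real.sinh (v / √y / 2)) ^ 2) * Real.cos (r * (v / √y)))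
    (f := fun v => Real.exp (-(1 / 4) * v ^ 2))
    (fun v => Real.exp (2 * j ^ 2) * Real.exp (-(1 / 8) * v ^ 2)) ?_ ?_ ?_ ?_
  · refine h.congr' ?_
    filter_upwards [eventually_gt_atTop 0] with y hy
    have hs : 0 < √y := Real.sqrt_pos.2 hy
    have h1 := Measure.integral_comp_div (fun u => Real.cosh u ^ j *
      Real.exp (-(√y * Real.sinh (u / 2)) ^ 2) * Real.cos (r * u)) √y
    rw [h1, abs_of_pos hs, smul_eq_mul, coshIntegral, mul_assoc √y,
      ← integral_const_mul (Real.exp (y / 2))]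
    congr 1
    refine integral_congr_ae (Eventually.of_forall fun u => ?_)
    simp only
    have h2 : Real.exp (-(√y * Real.sinh (u / 2)) ^ 2) =
        Real.exp (y / 2) * Real.exp (-(y / 2) * Real.cosh u) := by
      rw [← Real.exp_add, hcosh u, mul_pow, Real.sq_sqrt hy.le]
      ring_nf
    rw [h2]
    ring
  · exact Eventually.of_forall fun y => by fun_prop
  · filter_upwards [eventually_ge_atTop 1] with y hy
    have hs : 1 ≤ √y := Real.one_le_sqrt.2 hy
    have hs0 : 0 < √y := by linarith
    refine Eventually.of_forall fun v => ?_
    have hc := Real.cosh_pos (v / √y)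
    rw [norm_mul, Real.norm_of_nonneg (by positivity), ← Real.exp_add]
    refine (mul_le_of_le_one_right (by positivity) (Real.abs_cos_le_one _)).trans ?_
    have h1 : Real.cosh (v / √y) ^ j ≤ Real.exp (j * |v|) := by
      rw [Real.exp_nat_mul]
      refine pow_le_pow_left₀ hc.le ((cosh_le_exp_abs _).trans (Real.exp_le_exp.2 ?_)) j
      rw [abs_div, abs_of_pos hs0]
      exact div_le_self (abs_nonneg v) hs
    have h2 : (v / 2) ^ 2 ≤ (√y * Real.sinh (v / √y / 2)) ^ 2 := by
      rw [sq_le_sq, abs_mul, abs_of_pos hs0, Real.abs_sinh]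
      calc |v / 2| = √y * |v / √y / 2| := by
            rw [abs_div, abs_div, abs_div, abs_of_pos hs0]; field_simp
        _ ≤ _ := mul_le_mul_of_nonneg_left (Real.self_le_sinh_iff.2 (abs_nonneg _)) hs0.le
    calc _ ≤ Real.exp (j * |v|) * Real.exp (-(v / 2) ^ 2) := by gcongr
      _ ≤ _ := by
        rw [← Real.exp_add]
        apply Real.exp_le_exp.2
        -- Completing the square: v²/8 - j|v| + 2j² = (|v| - 4j)²/8.
        nlinarith [sq_nonneg (|v| - 4 * j), sq_abs v]
  · exact (integrable_exp_neg_mul_sq (by norm_num)).const_mul _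
  · refine Eventually.of_forall fun v => ?_
    have hs : Tendsto (fun y : ℝ => (√y)⁻¹) atTop (𝓝[≠] 0) :=
      (tendsto_inv_atTop_nhdsGT_zero.comp Real.tendsto_sqrt_atTop).mono_right
        (nhdsWithin_mono _ fun x hx => ne_of_gt hx)
    have h0 : Tendsto (fun y : ℝ => v / √y) atTop (𝓝 0) := by
      simpa [div_eq_mul_inv] using (hs.mono_right nhdsWithin_le_nhds).const_mul v
    have hsinh : HasDerivAt (fun h => Real.sinh (v * h / 2)) (v / 2) 0 := by
      have := (((hasDerivAt_id (0 : ℝ)).const_mul v).div_const 2).sinh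
      simpa using this
    have h1 : Tendsto (fun y : ℝ => √y * Real.sinh (v / √y / 2)) atTop (𝓝 (v / 2)) := by
      have := (hasDerivAt_iff_tendsto_slope_zero.1 hsinh).comp hs
      refine this.congr fun y => ?_
      simp [div_eq_mul_inv]
    have h2 := (((Real.continuous_cosh.tendsto 0).comp h0).pow j).mul
      ((Real.continuous_exp.tendsto _).comp (h1.pow 2).neg)
    have h3 := h2.mul ((Real.continuous_cos.tendsto _).comp (h0.const_mul r))
    rw [Real.cosh_zero, mul_zero, Real.cos_zero, one_pow, one_mul, mul_one] at h3
    rw [show -(1 / 4) * v ^ 2 = -(v / 2) ^ 2 by ring]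
    exact h3

/-- The Whittaker function `W_{0,ir}(y) = √(y / π) K_{ir}(y / 2)`. -/
noncomputable def whittakerZero (r y : ℝ) : ℝ := 1 / 2 * √(y / Real.pi) * coshIntegral r 0 y

/-- Each derivative of the cosh integral raises the power of cosh; `coshIntegral_two` eliminates the
second power and yields Whittaker's equation. The limits are those of Laplace's method for j = 0 and
j = 1. -/
theorem isRealWhittaker_whittakerZero (r : ℝ) : IsRealWhittaker r 0 (whittakerZero r)
    (fun y => 1 / 2 * √(y / Real.pi) * (coshIntegral r 0 y / (2 * y) - coshIntegral r 1 y / 2)) := by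
  have hpi := Real.pi_pos
  have hA : ∀ y : ℝ, 0 < y → HasDerivAt (fun y => 1 / 2 * √(y / Real.pi))
      (1 / 2 * √(y / Real.pi) / (2 * y)) y := fun y hy => by
    have := (((hasDerivAt_id y).div_const Real.pi).sqrt (by simp; positivity)).const_mul (1 / 2)
    convert! this using 1
    have h1 : √(y / Real.pi) ^ 2 = y / Real.pi := Real.sq_sqrt (by positivity)
    have h2 : √(y / Real.pi) ≠ 0 := by positivity
    simp only [id]
    field_simp
    rw [h1]
    field_simp
  have hinv : Tendsto (fun y : ℝ => y⁻¹) atTop (𝓝 0) := tendsto_inv_atTop_zero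
  have hlim : ∀ j, Tendsto (fun y => Real.exp (y / 2) *
      (1 / 2 * √(y / Real.pi) * coshIntegral r j y)) atTop (𝓝 1) := fun j => by
    have := (tendsto_sqrt_mul_exp_mul_coshIntegral r j).const_mul (1 / 2 / √Real.pi)
    convert this.congr' ?_ using 2
    · field_simp
    · filter_upwards [eventually_gt_atTop 0] with y hy
      rw [Real.sqrt_div hy.le]
      ring
  have hb : ∀ j : ℕ, WhittakerBound
      (fun y => y ^ j * (1 / 2 * √(y / Real.pi) * coshIntegral r j y)) := fun j => by
    obtain ⟨C, hC, h⟩ := exists_abs_coshIntegral_le r j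
    refine ⟨1 / 2 / √Real.pi * C, 0, by positivity, fun y hy => ?_⟩
    rw [norm_mul, norm_mul, Real.norm_of_nonneg (by positivity : 0 ≤ y ^ j),
      Real.norm_of_nonneg (by positivity : 0 ≤ 1 / 2 * √(y / Real.pi)), Real.norm_eq_abs]
    have e1 : y ^ (3 / 8 : ℝ) = y ^ j * √y * y ^ (-(j + 1 / 8) : ℝ) := by
      rw [Real.sqrt_eq_rpow, ← Real.rpow_natCast, ← Real.rpow_add hy, ← Real.rpow_add hy]
      congr 1; ring
    calc _ ≤ y ^ j * (1 / 2 * √(y / Real.pi) *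
          (C * (y ^ (-(j + 1 / 8) : ℝ) * Real.exp (-y / 4)))) := by
          gcongr; exact h y hy
      _ = _ := by rw [e1, Real.sqrt_div hy.le]; ring
  refine ⟨fun y hy => ?_, fun y hy => ?_, ?_, ?_, ?_, ?_⟩
  · have := (hA y hy).mul (hasDerivAt_coshIntegral r 0 hy)
    convert! this using 1
    ring
  · have := (hA y hy).mul (((hasDerivAt_coshIntegral r 0 hy).div
      ((hasDerivAt_id y).const_mul 2) (by simpa using hy.ne')).sub
      ((hasDerivAt_coshIntegral r 1 hy).div_const 2))
    convert! this using 1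
    have e := coshIntegral_two r hy
    have e2 : coshIntegral r 2 y = (y / 2 * coshIntegral r 1 y +
        (y ^ 2 / 4 - r ^ 2) * coshIntegral r 0 y) * 4 / y ^ 2 := by
      rw [← e]; field_simp
    simp only [id, whittakerZero, Pi.sub_apply, Pi.div_apply, zero_add, Nat.reduceAdd, e2]
    push_cast
    field_simp
    ring
  · simpa [whittakerZero] using hlim 0
  · have := ((hinv.mul (hlim 0)).const_mul (1 / 2)).sub ((hlim 1).const_mul (1 / 2))
    convert this.congr' ?_ using 2
    · norm_num
    · filter_upwards [eventually_gt_atTop 0] with y hy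
      simp
      field_simp
  · exact (hb 0).congr fun y _ => by simp [whittakerZero]
  · refine (((hb 0).const_mul (1 / 2)).sub ((hb 1).const_mul (1 / 2))).congr fun y hy => ?_
    simp
    field_simp

/-! ### Mellin transform of the square of W_{0,ir} -/

/-- The Beta integral in hyperbolic form. -/
lemma integral_cosh_cpow_mul_exp (s : ℂ) (hs : 0 < s.re) (r : ℝ) :
    ∫ p : ℝ, (Real.cosh p : ℂ) ^ (-s) * Complex.exp (2 * Complex.I * r * p) =
      2 ^ (s - 1) * (Complex.Gamma (s / 2 + Complex.I * r) * Complex.Gamma (s / 2 - Complex.I * r) /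
        Complex.Gamma s) := by
  set A : ℂ := s / 2 + Complex.I * r with hA
  set B : ℂ := s / 2 - Complex.I * r with hB
  have hAB : A + B = s := by rw [hA, hB]; ring
  have hAre : 0 < A.re := by simp [hA]; exact hs
  have hBre : 0 < B.re := by simp [hB]; exact hs
  have hG := Complex.Gamma_mul_Gamma_eq_betaIntegral hAre hBre
  rw [hAB] at hG
  have hGs := Complex.Gamma_ne_zero_of_re_pos hs
  rw [hG, mul_div_cancel_left₀ _ hGs, Complex.betaIntegral,
    intervalIntegral.integral_of_le zero_le_one, integral_Ioc_eq_integral_Ioo]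
  -- The logistic substitution x = f(p): since f' = 2f(1 - f), the Beta integrand becomes 2 f^A (1 -
  -- f)^B = 2 e^{(A-B)p} (2 cosh p)^{-s}, with A - B = 2ir.
  set f : ℝ → ℝ := fun p => Real.exp p / (2 * Real.cosh p) with hf
  have hc := fun p => Real.cosh_pos p
  have hf1 : ∀ p, 1 - f p = Real.exp (-p) / (2 * Real.cosh p) := fun p => by
    have := hc p
    simp only [hf]
    field_simp
    rw [Real.cosh_eq]; ring
  have hfpos : ∀ p, 0 < f p := fun p => by have := hc p; positivity
  have hfpos1 : ∀ p, 0 < 1 - f p := fun p => by rw [hf1]; have := hc p; positivity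
  have hd : ∀ p, HasDerivAt f (2 * f p * (1 - f p)) p := fun p => by
    have := (Real.hasDerivAt_exp p).div ((Real.hasDerivAt_cosh p).const_mul 2)
      (by have := hc p; positivity)
    convert! this using 1
    rw [hf1]
    simp only [hf]
    have := hc p
    field_simp
    rw [Real.cosh_eq, Real.sinh_eq]; ring
  have himg : f '' Set.univ = Set.Ioo 0 1 := by
    ext x
    simp only [Set.image_univ, Set.mem_range, Set.mem_Ioo]
    constructor
    · rintro ⟨p, rfl⟩
      exact ⟨hfpos p, by linarith [hfpos1 p]⟩
    · rintro ⟨h0, h1⟩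
      have h1' : 0 < 1 - x := by linarith
      refine ⟨Real.log (x / (1 - x)) / 2, ?_⟩
      set p := Real.log (x / (1 - x)) / 2 with hp
      have e2 : Real.exp p * Real.exp p = x / (1 - x) := by
        rw [← Real.exp_add, hp, add_halves, Real.exp_log (by positivity)]
      have e3 : f p = Real.exp p * Real.exp p / (Real.exp p * Real.exp p + 1) := by
        simp only [hf]
        rw [Real.cosh_eq, Real.exp_neg]
        have := Real.exp_pos p
        field_simp
      rw [e3, e2]
      field_simp
      ring
  have hinj : Set.InjOn f Set.univ := by
    refine (strictMono_of_deriv_pos fun p => ?_).injective.injOn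
    rw [(hd p).deriv]
    have := hfpos p; have := hfpos1 p
    positivity
  rw [← himg, integral_image_eq_integral_abs_deriv_smul MeasurableSet.univ
    (fun p _ => (hd p).hasDerivWithinAt) hinj, setIntegral_univ, ← integral_const_mul]
  refine integral_congr_ae (Eventually.of_forall fun p => ?_)
  have h2c : (0 : ℝ) < 2 * Real.cosh p := by have := hc p; positivity
  have hcpow : ∀ (x : ℝ) (z : ℂ), 0 < x → (x : ℂ) ^ (z - 1) * x = (x : ℂ) ^ z := fun x z hx => by
    have hx' : (x : ℂ) ≠ 0 := by exact_mod_cast hx.ne'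
    rw [Complex.cpow_sub _ _ hx', Complex.cpow_one, div_mul_cancel₀ _ hx']
  have hexp : ∀ (x : ℝ) (z : ℂ), ((Real.exp x / (2 * Real.cosh p) : ℝ) : ℂ) ^ z =
      Complex.exp (x * z) * ((2 * Real.cosh p : ℝ) : ℂ) ^ (-z) := fun x z => by
    rw [div_eq_mul_inv, Complex.ofReal_mul, Complex.mul_cpow_ofReal_nonneg (Real.exp_pos x).le
      (by positivity), Complex.ofReal_inv, Complex.inv_cpow _ _
      (by rw [Complex.arg_ofReal_of_nonneg h2c.le]; exact Real.pi_pos.ne), Complex.cpow_neg]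
    congr 1
    rw [Complex.cpow_def_of_ne_zero (by exact_mod_cast (Real.exp_pos x).ne'), ← Complex.ofReal_log
      (Real.exp_pos x).le, Real.log_exp]
  have h1 : ((1 : ℂ) - (f p : ℂ)) = ((1 - f p : ℝ) : ℂ) := by push_cast; rfl
  simp only
  rw [abs_of_pos (by have := hfpos p; have := hfpos1 p; positivity), h1, Complex.real_smul]
  calc (Real.cosh p : ℂ) ^ (-s) * Complex.exp (2 * Complex.I * r * p)
      = 2 ^ (s - 1) * (2 * (Complex.exp (p * A) * Complex.exp (((-p : ℝ) : ℂ) * B) *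
          ((2 * Real.cosh p : ℝ) : ℂ) ^ (-s))) := by
        rw [← Complex.exp_add, show (p : ℂ) * A + ((-p : ℝ) : ℂ) * B = 2 * Complex.I * r * p by
          rw [hA, hB]; push_cast; ring, Complex.ofReal_mul, Complex.mul_cpow_ofReal_nonneg
          two_pos.le (hc p).le, Complex.cpow_sub _ _ two_ne_zero, Complex.cpow_one,
          Complex.ofReal_ofNat, Complex.cpow_neg 2 s]
        have : (2 : ℂ) ^ s ≠ 0 := by simp [Complex.cpow_eq_zero_iff]
        field_simp
    _ = 2 ^ (s - 1) * (2 * (((f p : ℝ) : ℂ) ^ A * ((1 - f p : ℝ) : ℂ) ^ B)) := by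
        rw [hf1, hexp, hexp, ← hAB, neg_add,
          Complex.cpow_add _ _ (by exact_mod_cast h2c.ne')]
        ring
    _ = _ := by
        rw [← hcpow _ A (hfpos p), ← hcpow _ B (hfpos1 p)]
        push_cast
        ring

/-- The exponential form of `coshIntegral r 0`. -/
lemma integral_exp_cosh_mul_exp (r : ℝ) {y : ℝ} (hy : 0 < y) :
    Integrable (fun u : ℝ => Complex.exp (-(y / 2) * Real.cosh u + Complex.I * r * u)) ∧
    ∫ u : ℝ, Complex.exp (-(y / 2) * Real.cosh u + Complex.I * r * u) = coshIntegral r 0 y := by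
  have hcos := integrable_cosh_pow_mul_exp_mul 0 hy (g := fun u => Real.cos (r * u))
    (by fun_prop) fun u => Real.abs_cos_le_one _
  have hsin := integrable_cosh_pow_mul_exp_mul 0 hy (g := fun u => Real.sin (r * u))
    (by fun_prop) fun u => Real.abs_sin_le_one _
  have hs0 : ∫ u : ℝ, Real.cosh u ^ 0 * Real.exp (-(y / 2) * Real.cosh u) * Real.sin (r * u)
      = 0 := by
    have := integral_neg_eq_self
      (fun u : ℝ => Real.cosh u ^ 0 * Real.exp (-(y / 2) * Real.cosh u) * Real.sin (r * u)) volume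
    simp only [Real.cosh_neg, mul_neg, Real.sin_neg] at this
    rw [integral_neg] at this
    linarith
  have he : (fun u : ℝ => Complex.exp (-(y / 2) * Real.cosh u + Complex.I * r * u)) =
      fun u : ℝ => ((Real.cosh u ^ 0 * Real.exp (-(y / 2) * Real.cosh u) * Real.cos (r * u) : ℝ) : ℂ)
        + Complex.I * ((Real.cosh u ^ 0 * Real.exp (-(y / 2) * Real.cosh u) *
          Real.sin (r * u) : ℝ) : ℂ) := by
    funext u
    rw [Complex.exp_add, show Complex.I * r * u = ((r * u : ℝ) : ℂ) * Complex.I by push_cast; ring,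
      Complex.exp_mul_I]
    push_cast
    ring
  rw [he]
  refine ⟨hcos.ofReal.add (hsin.ofReal.const_mul _), ?_⟩
  rw [integral_add hcos.ofReal (hsin.ofReal.const_mul _), integral_const_mul,
    integral_complex_ofReal, integral_complex_ofReal, hs0, coshIntegral]
  simp

/-- The bound e^{-x} ≤ 1/x for x > 0 separates the two variables. -/
lemma integrable_exp_neg_cosh_mul_cosh (r : ℝ) {y : ℝ} (hy : 0 < y) :
    Integrable (fun z : ℝ × ℝ => Complex.exp (-(y * (Real.cosh z.1 * Real.cosh z.2))) *
      Complex.exp (2 * Complex.I * r * z.1)) := by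
  have hi := integrable_cosh_rpow_neg one_pos
  refine ((hi.mul_prod hi).const_mul y⁻¹).mono' (by fun_prop) (Eventually.of_forall fun z => ?_)
  have h1 := Real.cosh_pos z.1
  have h2 := Real.cosh_pos z.2
  rw [norm_mul, Complex.norm_exp, Complex.norm_exp]
  have e : (-(y * (Real.cosh z.1 * Real.cosh z.2)) : ℂ).re =
      -(y * (Real.cosh z.1 * Real.cosh z.2)) := by
    rw [← Complex.ofReal_mul, ← Complex.ofReal_mul, ← Complex.ofReal_neg, Complex.ofReal_re]
  have e2 : (2 * Complex.I * r * z.1 : ℂ).re = 0 := by simp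
  rw [e, e2, Real.exp_zero, mul_one, Real.exp_neg, Real.rpow_neg_one, Real.rpow_neg_one,
    ← mul_inv, ← mul_inv]
  exact inv_anti₀ (by positivity)
    (by linarith [Real.add_one_le_exp (y * (Real.cosh z.1 * Real.cosh z.2))])

/-- In the product of two integrals over u and v put u = p + q, v = p - q: then cosh u + cosh v = 2
cosh p cosh q, u + v = 2p, and the Jacobian is 2. The change of variables is carried out through the
integral of a convolution. -/
lemma coshIntegral_sq (r : ℝ) {y : ℝ} (hy : 0 < y) :
    ((coshIntegral r 0 y : ℝ) : ℂ) ^ 2 =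
      2 * ∫ z : ℝ × ℝ, Complex.exp (-(y * (Real.cosh z.1 * Real.cosh z.2))) *
        Complex.exp (2 * Complex.I * r * z.1) := by
  obtain ⟨hi, he⟩ := integral_exp_cosh_mul_exp r hy
  set f : ℝ → ℂ := fun u => Complex.exp (-(y / 2) * Real.cosh u + Complex.I * r * u) with hf
  have hconv := integral_convolution (μ := volume) (ν := volume)
    (ContinuousLinearMap.mul ℂ ℂ) hi hi
  rw [he, ContinuousLinearMap.mul_apply'] at hconv
  rw [sq, ← hconv, Measure.volume_eq_prod, integral_prod _ (integrable_exp_neg_cosh_mul_cosh r hy)]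
  have h2 := Measure.integral_comp_mul_left
    (fun x => convolution f f (ContinuousLinearMap.mul ℂ ℂ) volume x) 2
  rw [abs_of_pos (by norm_num), Complex.real_smul] at h2
  have h3 : ∫ x, convolution f f (ContinuousLinearMap.mul ℂ ℂ) volume x =
      2 * ∫ p : ℝ, convolution f f (ContinuousLinearMap.mul ℂ ℂ) volume (2 * p) := by
    rw [h2]; push_cast; ring
  rw [h3]
  congr 1
  refine integral_congr_ae (Eventually.of_forall fun p => ?_)
  simp only [convolution_def, ContinuousLinearMap.mul_apply']
  rw [← integral_add_left_eq_self _ p]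
  refine integral_congr_ae (Eventually.of_forall fun q => ?_)
  simp only [hf]
  rw [← Complex.exp_add, ← Complex.exp_add]
  congr 1
  rw [show 2 * p - (p + q) = p - q by ring, Real.cosh_add, Real.cosh_sub]
  push_cast
  ring

/-- The Mellin transform of the square of `W_{0,ir}`. -/
theorem integral_whittakerZero_sq (r : ℝ) {s : ℂ} (hs : 0 < s.re) :
    ∫ y in Set.Ioi (0 : ℝ), (whittakerZero r y : ℂ) ^ 2 * (y : ℂ) ^ (s - 2) =
      4 ^ (s - 1) / (2 * Real.pi) * (Complex.Gamma (s / 2) ^ 2 *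
        Complex.Gamma (s / 2 + Complex.I * r) * Complex.Gamma (s / 2 - Complex.I * r) /
        Complex.Gamma s) := by
  have hGs := Complex.Gamma_ne_zero_of_re_pos hs
  set G : ℝ → ℝ × ℝ → ℂ := fun y z => (y : ℂ) ^ (s - 1) *
    (Complex.exp (-(y * (Real.cosh z.1 * Real.cosh z.2))) * Complex.exp (2 * Complex.I * r * z.1))
    with hGdef
  have hnorm : ∀ y : ℝ, 0 < y → ∀ z, ‖G y z‖ =
      y ^ (s.re - 1) * Real.exp (-(Real.cosh z.1 * Real.cosh z.2 * y)) := fun y hy z => by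
    simp only [hGdef]
    rw [norm_mul, norm_mul, Complex.norm_cpow_eq_rpow_re_of_pos hy, Complex.norm_exp,
      Complex.norm_exp, ← Complex.ofReal_mul, ← Complex.ofReal_mul, ← Complex.ofReal_neg,
      Complex.ofReal_re]
    simp only [Complex.sub_re, Complex.one_re, Complex.mul_re, Complex.re_ofNat, Complex.I_re,
      mul_zero, Complex.im_ofNat, Complex.I_im, mul_one, sub_self, Complex.ofReal_re, zero_mul,
      Complex.mul_im, zero_add, Complex.ofReal_im, add_zero, Real.exp_zero]
    ring_nf
  have hmeas : Measurable (Function.uncurry G) := by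
    have h1 : Measurable fun x : ℝ × ℝ × ℝ => (x.1 : ℂ) ^ (s - 1) :=
      (Complex.measurable_ofReal.comp measurable_fst).pow_const _
    have h2 : Measurable fun x : ℝ × ℝ × ℝ =>
      Complex.exp (-(x.1 * (Real.cosh x.2.1 * Real.cosh x.2.2))) *
        Complex.exp (2 * Complex.I * r * x.2.1) := by fun_prop
    exact h1.mul h2
  have hcc : ∀ z : ℝ × ℝ, 0 < Real.cosh z.1 * Real.cosh z.2 := fun z =>
    mul_pos (Real.cosh_pos _) (Real.cosh_pos _)
  have hint : Integrable (Function.uncurry G)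
      ((volume.restrict (Set.Ioi (0 : ℝ))).prod (volume : Measure (ℝ × ℝ))) := by
    rw [integrable_prod_iff' hmeas.aestronglyMeasurable]
    constructor
    · refine Eventually.of_forall fun z => ?_
      have h1 := integrableOn_rpow_mul_exp_neg_mul_rpow (s := s.re - 1) (p := 1) (by linarith)
        one_pos (hcc z)
      refine Integrable.mono' h1
        (hmeas.comp (measurable_id.prodMk measurable_const)).aestronglyMeasurable ?_
      filter_upwards [ae_restrict_mem measurableSet_Ioi] with y hy
      rw [Function.uncurry_apply_pair, hnorm y hy, Real.rpow_one, neg_mul]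
    · have hi := integrable_cosh_rpow_neg hs
      refine ((hi.mul_prod hi).mul_const (Real.Gamma s.re)).congr (Eventually.of_forall fun z => ?_)
      have h1 := Real.integral_rpow_mul_exp_neg_mul_Ioi hs (hcc z)
      simp only [Function.uncurry_apply_pair]
      rw [setIntegral_congr_fun measurableSet_Ioi fun y hy => hnorm y hy z, h1, one_div,
        Real.inv_rpow (hcc z).le, ← Real.rpow_neg (hcc z).le,
        Real.mul_rpow (Real.cosh_pos _).le (Real.cosh_pos _).le]
  calc ∫ y in Set.Ioi (0 : ℝ), (whittakerZero r y : ℂ) ^ 2 * (y : ℂ) ^ (s - 2)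
      = ∫ y in Set.Ioi (0 : ℝ), 1 / (2 * Real.pi) * ∫ z, G y z := by
        refine setIntegral_congr_fun measurableSet_Ioi fun y hy => ?_
        have hy' : 0 < y := hy
        have hy0 : (y : ℂ) ≠ 0 := by exact_mod_cast hy'.ne'
        simp only [hGdef]
        rw [integral_const_mul, whittakerZero, Complex.ofReal_mul, mul_pow, coshIntegral_sq r hy',
          ← Complex.ofReal_pow, mul_pow, Real.sq_sqrt (by have := Real.pi_pos; positivity),
          show s - 1 = s - 2 + 1 by ring, Complex.cpow_add _ _ hy0, Complex.cpow_one]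
        push_cast
        ring
    _ = 1 / (2 * Real.pi) * ∫ z, ∫ y in Set.Ioi (0 : ℝ), G y z := by
        rw [integral_const_mul, integral_integral_swap hint]
    -- The y-integral gives Γ(s) (cosh p cosh q)^{-s}. The trivial factor with 0 in place of r puts
    -- the q-integral in the form of the same Beta integral.
    _ = 1 / (2 * Real.pi) * ∫ z : ℝ × ℝ, Complex.Gamma s *
          (((Real.cosh z.1 : ℂ) ^ (-s) * Complex.exp (2 * Complex.I * r * z.1)) *
            ((Real.cosh z.2 : ℂ) ^ (-s) * Complex.exp (2 * Complex.I * (0 : ℝ) * z.2))) := by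
        congr 1
        refine integral_congr_ae (Eventually.of_forall fun z => ?_)
        have h1 := Complex.integral_cpow_mul_exp_neg_mul_Ioi hs (hcc z)
        have h2 : ∀ y : ℝ, G y z = Complex.exp (2 * Complex.I * r * z.1) * ((y : ℂ) ^ (s - 1) *
            Complex.exp (-(((Real.cosh z.1 * Real.cosh z.2 : ℝ) : ℂ) * y))) := fun y => by
          simp only [hGdef]
          rw [Complex.ofReal_mul, mul_comm (y : ℂ)]
          ring
        simp only [h2]
        rw [integral_const_mul, h1, one_div, Complex.inv_cpow _ _
          (by rw [Complex.arg_ofReal_of_nonneg (hcc z).le]; exact Real.pi_pos.ne),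
          ← Complex.cpow_neg, Complex.ofReal_mul, Complex.mul_cpow_ofReal_nonneg
          (Real.cosh_pos _).le (Real.cosh_pos _).le]
        simp only [Complex.ofReal_zero, mul_zero, zero_mul, Complex.exp_zero, mul_one]
        ring
    _ = _ := by
        rw [integral_const_mul, Measure.volume_eq_prod, integral_prod_mul
          (fun p : ℝ => (Real.cosh p : ℂ) ^ (-s) * Complex.exp (2 * Complex.I * r * p))
          (fun q : ℝ => (Real.cosh q : ℂ) ^ (-s) * Complex.exp (2 * Complex.I * (0 : ℝ) * q)),
          integral_cosh_cpow_mul_exp s hs r, integral_cosh_cpow_mul_exp s hs 0]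
        have h4 : (4 : ℂ) ^ (s - 1) = 2 ^ (s - 1) * 2 ^ (s - 1) := by
          have := Complex.mul_cpow_ofReal_nonneg two_pos.le two_pos.le (s - 1)
          rw [Complex.ofReal_ofNat] at this
          rw [← this]; norm_num
        rw [h4, Complex.ofReal_zero, mul_zero, add_zero, sub_zero]
        field_simp

/-! ### Decay of the Gamma function -/

/-- A shift of j by 1/2 adds M + 1/2 to a factor, half of (M + 1)² - M². Squared ratios are thus
close to ((M + 1)² + τ²) / (M² + τ²), which telescopes; the errors are O(1/M²), and the exponential
sums them in telescoping form. -/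
lemma prod_sq_mul_le (τ : ℝ) (N : ℕ) :
    (∏ j ∈ Finset.range (N + 1), ((j + 3 / 4 : ℝ) ^ 2 + τ ^ 2) ^ 2) * (1 + τ ^ 2) ≤
      81 * Real.exp (9 / 2 * (1 - 1 / (N + 1))) * ((N + 1) ^ 2 + τ ^ 2) *
        ∏ j ∈ Finset.range (N + 1), ((j + 1 / 4 : ℝ) ^ 2 + τ ^ 2) ^ 2 := by
  induction N with
  -- 81 = 9², from 9/16 + τ² ≤ 9 (1/16 + τ²).
  | zero =>
    simp
    nlinarith [sq_nonneg τ, pow_nonneg (sq_nonneg τ) 2, pow_nonneg (sq_nonneg τ) 3]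
  | succ N ih =>
    rw [Finset.prod_range_succ, Finset.prod_range_succ (fun j : ℕ => ((j + 1 / 4 : ℝ) ^ 2 + τ ^ 2) ^ 2)]
    set M : ℝ := (N : ℝ) + 1 with hM
    have hM1 : 1 ≤ M := by rw [hM]; linarith [Nat.cast_nonneg (α := ℝ) N]
    have hcast : ((N + 1 : ℕ) : ℝ) = M := by push_cast; rfl
    rw [hcast]
    have hstep : ((M + 3 / 4) ^ 2 + τ ^ 2) ^ 2 * (M ^ 2 + τ ^ 2) ≤
        Real.exp (9 / 2 * (1 / M - 1 / (M + 1))) * ((M + 1) ^ 2 + τ ^ 2) *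
          ((M + 1 / 4) ^ 2 + τ ^ 2) ^ 2 := by
      -- Since M + 1 ≤ 2M, 1/M - 1/(M + 1) ≥ 1/(2M²); hence 9/2 in the exponent for 9/4 here.
      have h1 : 1 + 9 / 4 / M ^ 2 ≤ Real.exp (9 / 2 * (1 / M - 1 / (M + 1))) := by
        refine le_trans ?_ (Real.add_one_le_exp _)
        rw [add_comm]
        gcongr
        rw [div_sub_div _ _ (by positivity) (by positivity), ← mul_div_assoc,
          div_le_div_iff₀ (by positivity) (by positivity)]
        nlinarith
      set a := (M + 1 / 4) ^ 2 + τ ^ 2 with ha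
      set D := M ^ 2 + τ ^ 2 with hD
      have hD0 : 0 < D := by positivity
      have ha0 : 0 < a := by positivity
      have hDa : D ≤ a := by rw [ha, hD]; nlinarith
      have hq : (M + 3 / 4) ^ 2 + τ ^ 2 ≤ a * (1 + (M + 1 / 2) / D) := by
        have : (M + 1 / 2) ≤ a * ((M + 1 / 2) / D) := by
          rw [← mul_div_assoc, le_div_iff₀ hD0]; nlinarith
        rw [ha] at this ⊢
        nlinarith
      have hv : ((M + 1 / 2) / D) ^ 2 ≤ 9 / 4 / M ^ 2 := by
        have : (M + 1 / 2) / D ≤ 3 / 2 / M := by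
          rw [div_le_div_iff₀ hD0 (by positivity)]; nlinarith [sq_nonneg τ]
        calc _ ≤ (3 / 2 / M) ^ 2 := by gcongr
          _ = _ := by rw [div_pow]; norm_num
      -- Expanding the square, the constant and linear terms give exactly (M + 1)² + τ²; only the
      -- quadratic term is an error.
      have hX : (1 + (M + 1 / 2) / D) ^ 2 * D ≤ (1 + 9 / 4 / M ^ 2) * ((M + 1) ^ 2 + τ ^ 2) := by
        have e : (M + 1) ^ 2 + τ ^ 2 = D + 2 * ((M + 1 / 2) / D) * D := by
          rw [hD]; field_simp; ring
        have h0 : 0 ≤ (M + 1 / 2) / D * D := by positivity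
        have h3 : 0 ≤ 9 / 4 / M ^ 2 := by positivity
        have h4 := mul_le_mul_of_nonneg_right hv hD0.le
        have h5 := mul_nonneg h3 h0
        rw [e]
        nlinarith
      calc ((M + 3 / 4) ^ 2 + τ ^ 2) ^ 2 * D ≤ (a * (1 + (M + 1 / 2) / D)) ^ 2 * D := by gcongr
        _ = a ^ 2 * ((1 + (M + 1 / 2) / D) ^ 2 * D) := by ring
        _ ≤ a ^ 2 * ((1 + 9 / 4 / M ^ 2) * ((M + 1) ^ 2 + τ ^ 2)) := by gcongr
        _ ≤ a ^ 2 * (Real.exp (9 / 2 * (1 / M - 1 / (M + 1))) * ((M + 1) ^ 2 + τ ^ 2)) := by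
          gcongr
        _ = _ := by ring
    have hexp : Real.exp (9 / 2 * (1 - 1 / (M + 1))) =
        Real.exp (9 / 2 * (1 - 1 / M)) * Real.exp (9 / 2 * (1 / M - 1 / (M + 1))) := by
      rw [← Real.exp_add]; congr 1; ring
    have hD0 : 0 < M ^ 2 + τ ^ 2 := by positivity
    refine le_of_mul_le_mul_right ?_ hD0
    calc _ = ((∏ j ∈ Finset.range (N + 1), ((j + 3 / 4 : ℝ) ^ 2 + τ ^ 2) ^ 2) * (1 + τ ^ 2)) *
          (((M + 3 / 4) ^ 2 + τ ^ 2) ^ 2 * (M ^ 2 + τ ^ 2)) := by ring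
      _ ≤ _ := mul_le_mul ih hstep (by positivity) (by positivity)
      _ = _ := by rw [hexp]; ring

lemma norm_GammaSeq_pow_four {z : ℂ} {σ τ : ℝ} (hz : z = σ + Complex.I * τ) {n : ℕ} (hn : n ≠ 0) :
    ‖Complex.GammaSeq z n‖ ^ 4 = (n : ℝ) ^ (4 * σ) * (n.factorial : ℝ) ^ 4 /
      ∏ j ∈ Finset.range (n + 1), ((j + σ) ^ 2 + τ ^ 2) ^ 2 := by
  have hre : z.re = σ := by simp [hz]
  rw [Complex.GammaSeq, norm_div, norm_mul, norm_prod, Complex.norm_natCast, div_pow, mul_pow,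
    ← Complex.ofReal_natCast, Complex.norm_cpow_eq_rpow_re_of_pos (by positivity), hre,
    ← Finset.prod_pow, ← Real.rpow_natCast, ← Real.rpow_mul (by positivity), mul_comm σ]
  congr 1
  refine Finset.prod_congr rfl fun j _ => ?_
  rw [show (4 : ℕ) = 2 * 2 by norm_num, pow_mul, Complex.sq_norm, Complex.normSq_apply]
  congr 1
  simp [hz]
  ring

/-- Limit of `prod_sq_mul_le` in Euler's formula for Γ. The factors n and n³ of the two sequences
differ by n², which normalises (n + 1)² + τ². -/
lemma norm_Gamma_quarter_pow_four_le (τ : ℝ) :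
    ‖Complex.Gamma (1 / 4 + Complex.I * τ)‖ ^ 4 * (1 + τ ^ 2) ≤
      81 * Real.exp (9 / 2) * ‖Complex.Gamma (3 / 4 - Complex.I * τ)‖ ^ 4 := by
  have h1 := ((Complex.GammaSeq_tendsto_Gamma (1 / 4 + Complex.I * τ)).norm.pow 4).mul_const
    (1 + τ ^ 2)
  have hlim : Tendsto (fun n : ℕ => ((n + 1 : ℝ) ^ 2 + τ ^ 2) / n ^ 2) atTop (𝓝 1) := by
    have h0 : Tendsto (fun n : ℕ => ((n : ℝ))⁻¹) atTop (𝓝 0) := tendsto_inv_atTop_nhds_zero_nat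
    have := ((h0.const_add 1).pow 2).add ((h0.pow 2).const_mul (τ ^ 2))
    convert this.congr' ?_ using 2
    · norm_num
    · filter_upwards [eventually_ne_atTop 0] with n hn
      have : (n : ℝ) ≠ 0 := by exact_mod_cast hn
      field_simp
  have h2 := (hlim.const_mul (81 * Real.exp (9 / 2))).mul
    ((Complex.GammaSeq_tendsto_Gamma (3 / 4 - Complex.I * τ)).norm.pow 4)
  rw [mul_one] at h2
  refine le_of_tendsto_of_tendsto h1 h2 ?_
  filter_upwards [eventually_ne_atTop 0] with n hn
  have hn0 : (0 : ℝ) < n := by positivity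
  rw [norm_GammaSeq_pow_four (σ := 1 / 4) (τ := τ) (by push_cast; ring) hn,
    norm_GammaSeq_pow_four (σ := 3 / 4) (τ := -τ) (by push_cast; ring) hn, neg_sq]
  have h3 := prod_sq_mul_le τ n
  have h4 : Real.exp (9 / 2 * (1 - 1 / (n + 1))) ≤ Real.exp (9 / 2) := by
    apply Real.exp_le_exp.2
    have : (0 : ℝ) ≤ 1 / (n + 1) := by positivity
    linarith
  set A := ∏ j ∈ Finset.range (n + 1), ((j + 1 / 4 : ℝ) ^ 2 + τ ^ 2) ^ 2 with hA
  set B := ∏ j ∈ Finset.range (n + 1), ((j + 3 / 4 : ℝ) ^ 2 + τ ^ 2) ^ 2 with hB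
  have hA0 : 0 < A := Finset.prod_pos fun j _ => by positivity
  have hB0 : 0 < B := Finset.prod_pos fun j _ => by positivity
  have h5 : B * (1 + τ ^ 2) ≤ 81 * Real.exp (9 / 2) * ((n + 1) ^ 2 + τ ^ 2) * A :=
    h3.trans (by gcongr)
  have e1 : (n : ℝ) ^ (4 * (1 / 4) : ℝ) = n := by norm_num
  have e3 : (n : ℝ) ^ (4 * (3 / 4) : ℝ) = n ^ 3 := by
    rw [← Real.rpow_natCast]; norm_num
  rw [e1, e3]
  calc n * (n.factorial : ℝ) ^ 4 / A * (1 + τ ^ 2)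
      = n * (n.factorial : ℝ) ^ 4 / (A * B) * (B * (1 + τ ^ 2)) := by field_simp
    _ ≤ n * (n.factorial : ℝ) ^ 4 / (A * B) *
        (81 * Real.exp (9 / 2) * ((n + 1) ^ 2 + τ ^ 2) * A) := by gcongr
    _ = _ := by field_simp

/-- At real part π/4 sine and cosine have equal squares, so |sin|² = (cosh² + sinh²)/2 =
cosh(2πτ)/2. -/
lemma exp_abs_le_norm_sin_sq (τ : ℝ) :
    Real.exp (2 * Real.pi * |τ|) / 4 ≤ ‖Complex.sin (Real.pi * (1 / 4 + Complex.I * τ))‖ ^ 2 := by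
  have e : (Real.pi * (1 / 4 + Complex.I * τ) : ℂ) =
      ((Real.pi / 4 : ℝ) : ℂ) + ((Real.pi * τ : ℝ) : ℂ) * Complex.I := by push_cast; ring
  rw [e, Complex.sin_add_mul_I, Complex.sq_norm, Complex.normSq_apply]
  have h2 : √2 ^ 2 = (2 : ℝ) := Real.sq_sqrt two_pos.le
  have hs := Real.cosh_sq (Real.pi * τ)
  have h1 := exp_abs_le_two_mul_cosh (2 * (Real.pi * τ))
  rw [Real.cosh_two_mul, abs_mul, abs_mul, abs_of_pos two_pos, abs_of_pos Real.pi_pos] at h1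
  rw [← Complex.ofReal_sin, ← Complex.ofReal_cos, ← Complex.ofReal_cosh, ← Complex.ofReal_sinh,
    Real.sin_pi_div_four, Real.cos_pi_div_four]
  simp only [Complex.add_re, Complex.mul_re, Complex.ofReal_re, Complex.ofReal_im, Complex.I_re,
    Complex.I_im, Complex.add_im, Complex.mul_im, mul_zero, zero_mul, sub_zero, add_zero, zero_add,
    mul_one, sub_self]
  rw [mul_assoc 2 Real.pi]
  nlinarith

/-- The decay of the Gamma function on the line `Re z = 1 / 4`. -/
theorem exists_norm_Gamma_quarter_le : ∃ C : ℝ, 0 < C ∧ ∀ τ : ℝ,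
    ‖Complex.Gamma (1 / 4 + Complex.I * τ)‖ ≤
      C * ((1 + |τ|) ^ (-(1 / 4) : ℝ) * Real.exp (-(Real.pi / 2) * |τ|)) := by
  have hpi := Real.pi_pos
  set K : ℝ := 81 * Real.exp (9 / 2) * Real.pi ^ 4 * 16 * 2 with hK
  have hK0 : 0 < K := by positivity
  refine ⟨K ^ (1 / 8 : ℝ), by positivity, fun τ => ?_⟩
  have h1 := norm_Gamma_quarter_pow_four_le τ
  have h2 : ‖Complex.Gamma (1 / 4 + Complex.I * τ)‖ * ‖Complex.Gamma (3 / 4 - Complex.I * τ)‖ *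
      ‖Complex.sin (Real.pi * (1 / 4 + Complex.I * τ))‖ = Real.pi := by
    have := Complex.Gamma_mul_Gamma_one_sub (1 / 4 + Complex.I * τ)
    rw [show 1 - (1 / 4 + Complex.I * τ) = 3 / 4 - Complex.I * τ by ring] at this
    have hs : Complex.sin (Real.pi * (1 / 4 + Complex.I * τ)) ≠ 0 := fun h0 => by
      have := exp_abs_le_norm_sin_sq τ
      rw [h0, norm_zero] at this
      have := Real.exp_pos (2 * Real.pi * |τ|)
      norm_num at *
      linarith
    rw [← norm_mul, this, ← norm_mul, div_mul_cancel₀ _ hs, Complex.norm_of_nonneg hpi.le]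
  have h3 := exp_abs_le_norm_sin_sq τ
  set G := ‖Complex.Gamma (1 / 4 + Complex.I * τ)‖
  set H := ‖Complex.Gamma (3 / 4 - Complex.I * τ)‖
  set S := ‖Complex.sin (Real.pi * (1 / 4 + Complex.I * τ))‖
  set E := Real.exp (2 * Real.pi * |τ|) with hE
  have hG : 0 ≤ G := norm_nonneg _
  have hS : 0 ≤ S := norm_nonneg _
  have hE0 : 0 < E := Real.exp_pos _
  have hτ : (1 + |τ|) ^ 2 ≤ 2 * (1 + τ ^ 2) := by nlinarith [sq_abs τ, sq_nonneg (|τ| - 1)]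
  -- The comparison G⁴(1 + τ²) ≤ const · H⁴, multiplied by G⁴S⁴, meets the reflection formula GHS =
  -- π; this avoids Stirling's formula.
  have h4 : G ^ 8 * ((1 + |τ|) ^ 2 * E ^ 2) ≤ K := by
    calc G ^ 8 * ((1 + |τ|) ^ 2 * E ^ 2) = G ^ 8 * (1 + |τ|) ^ 2 * (E / 4) ^ 2 * 16 := by ring
      _ ≤ G ^ 8 * (2 * (1 + τ ^ 2)) * (S ^ 2) ^ 2 * 16 := by gcongr
      _ = (G ^ 4 * (1 + τ ^ 2)) * (G ^ 4 * S ^ 4) * (16 * 2) := by ring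
      _ ≤ (81 * Real.exp (9 / 2) * H ^ 4) * (G ^ 4 * S ^ 4) * (16 * 2) := by gcongr
      _ = 81 * Real.exp (9 / 2) * (G * H * S) ^ 4 * 16 * 2 := by ring
      _ = K := by rw [h2]
  refine le_of_pow_le_pow_left₀ (n := 8) (by norm_num) (by positivity) ?_
  have e1 : (K ^ (1 / 8 : ℝ)) ^ 8 = K := by
    rw [← Real.rpow_natCast, ← Real.rpow_mul hK0.le]; norm_num
  have e2 : ((1 + |τ|) ^ (-(1 / 4) : ℝ)) ^ 8 = ((1 + |τ|) ^ 2)⁻¹ := by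
    rw [← Real.rpow_natCast, ← Real.rpow_mul (by positivity), ← Real.rpow_natCast,
      ← Real.rpow_neg (by positivity)]
    norm_num
  have e3 : Real.exp (-(Real.pi / 2) * |τ|) ^ 8 = (E ^ 2)⁻¹ := by
    rw [hE, ← Real.exp_nat_mul, ← Real.exp_nat_mul, ← Real.exp_neg]
    congr 1; push_cast; ring
  rw [mul_pow, mul_pow, e1, e2, e3, ← mul_inv, ← div_eq_mul_inv, le_div_iff₀ (by positivity)]
  exact h4

lemma Gamma_half_mul_Gamma_half (t : ℝ) :
    Complex.Gamma (1 / 2 + Complex.I * t) * Complex.Gamma (1 / 2 - Complex.I * t) =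
      Real.pi / Real.cosh (Real.pi * t) := by
  have := Complex.Gamma_mul_Gamma_one_sub (1 / 2 + Complex.I * t)
  rw [show 1 - (1 / 2 + Complex.I * t) = 1 / 2 - Complex.I * t by ring] at this
  rw [this, show (Real.pi * (1 / 2 + Complex.I * t) : ℂ) =
    Real.pi * t * Complex.I + Real.pi / 2 by ring, Complex.sin_add_pi_div_two, Complex.cos_mul_I]
  push_cast
  rfl

lemma norm_Gamma_half_sub (t : ℝ) :
    ‖Complex.Gamma (1 / 2 - Complex.I * t)‖ = ‖Complex.Gamma (1 / 2 + Complex.I * t)‖ := by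
  have := Complex.Gamma_conj (1 / 2 + Complex.I * t)
  rw [← Complex.norm_conj (Complex.Gamma (1 / 2 + Complex.I * t)), ← this]
  congr 2
  simp only [sub_eq_add_neg, map_add, map_mul, map_div₀, map_one, map_ofNat, Complex.conj_I,
    Complex.conj_ofReal, neg_mul]

lemma norm_Gamma_half_sq (t : ℝ) :
    ‖Complex.Gamma (1 / 2 + Complex.I * t)‖ ^ 2 = Real.pi / Real.cosh (Real.pi * t) := by
  have h := congrArg norm (Gamma_half_mul_Gamma_half t)
  rw [norm_mul, norm_Gamma_half_sub, ← sq, norm_div, Complex.norm_of_nonneg Real.pi_pos.le,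
    Complex.norm_of_nonneg (Real.cosh_pos _).le] at h
  exact h

lemma inv_norm_Gamma_half_sq_le (t : ℝ) :
    (‖Complex.Gamma (1 / 2 + Complex.I * t)‖ ^ 2)⁻¹ ≤ Real.exp (Real.pi * |t|) := by
  rw [norm_Gamma_half_sq, inv_div]
  have h := cosh_le_exp_abs (Real.pi * t)
  rw [abs_mul, abs_of_pos Real.pi_pos] at h
  exact (div_le_self (Real.cosh_pos _).le (by linarith [Real.pi_gt_three])).trans h

lemma inv_norm_Gamma_half_le (t : ℝ) :
    ‖Complex.Gamma (1 / 2 + Complex.I * t)‖⁻¹ ≤ Real.exp (Real.pi / 2 * |t|) := by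
  refine le_of_pow_le_pow_left₀ two_ne_zero (Real.exp_pos _).le ?_
  rw [inv_pow, ← Real.exp_nat_mul]
  exact (inv_norm_Gamma_half_sq_le t).trans_eq (by congr 1; push_cast; ring)

/-! ### Identification and contiguity of the functions W_{k,ir} -/

namespace IsRealWhittaker

variable {r : ℝ} {k : ℤ} {w w' v v' : ℝ → ℝ}

lemma eq_of_pos (h : IsRealWhittaker r k w w') (h₂ : IsRealWhittaker r k v v') {y : ℝ}
    (hy : 0 < y) : w y = v y ∧ w' y = v' y := by
  have hμ : (Complex.I * r) ^ 2 = -(r : ℂ) ^ 2 := by rw [mul_pow, Complex.I_sq]; ring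
  have key : ∀ z : ℝ, 0 < z → w z = v z := fun z hz => by
    exact_mod_cast (h.isWhittakerW hμ).eq_of_pos (h₂.isWhittakerW hμ) hz
  refine ⟨key y hy, (h.hasDerivAt y hy).unique ((h₂.hasDerivAt y hy).congr_of_eventuallyEq ?_)⟩
  filter_upwards [isOpen_Ioi.mem_nhds (Set.mem_Ioi.2 hy)] with z hz using key z hz

lemma whittakerW_eq (h : IsRealWhittaker r k w w') {μ : ℂ} (hμ : μ ^ 2 = -r ^ 2) {y : ℝ}
    (hy : 0 < y) : whittakerW k μ y = w y :=
  (Classical.epsilon_spec (p := IsWhittakerW k μ) ⟨_, h.isWhittakerW hμ⟩).eq_of_pos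
    (h.isWhittakerW hμ) hy

/-- The contiguity relation `2 y w_k' = (r ^ 2 + (k - 1 / 2) ^ 2) w_{k-1} - w_{k+1}`. -/
lemma two_mul_deriv {u u' : ℝ → ℝ} (hu : IsRealWhittaker r (k - 1) u u')
    (hw : IsRealWhittaker r k w w') (hv : IsRealWhittaker r (k + 1) v v') {y : ℝ} (hy : 0 < y) :
    2 * (y * w' y) = (r ^ 2 + (k - 1 / 2 : ℝ) ^ 2) * u y - v y := by
  -- By uniqueness v is the raising of w, and w with its derivative is the raising of u; the two
  -- expressions for y w' add up to the relation.
  have h1 := (hv.eq_of_pos hw.raise hy).1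
  have hu2 := hu.raise
  rw [sub_add_cancel] at hu2
  obtain ⟨h2, h3⟩ := hw.eq_of_pos hu2 hy
  rw [← h2, eq_div_iff hy.ne'] at h3
  push_cast at h3
  linarith

end IsRealWhittaker

lemma exists_isRealWhittaker (r : ℝ) (k : ℤ) :
    ∃ p : (ℝ → ℝ) × (ℝ → ℝ), IsRealWhittaker r k p.1 p.2 := by
  obtain ⟨w, w', h⟩ := IsRealWhittaker.exists_of_zero ⟨_, _, isRealWhittaker_whittakerZero r⟩ k
  exact ⟨(w, w'), h⟩

/-- The real-valued Whittaker function `W_{k,ir}`. -/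
noncomputable def realWhittaker (r : ℝ) (k : ℤ) : ℝ → ℝ := (exists_isRealWhittaker r k).choose.1

/-- The derivative of `realWhittaker`. -/
noncomputable def realWhittakerDeriv (r : ℝ) (k : ℤ) : ℝ → ℝ :=
  (exists_isRealWhittaker r k).choose.2

lemma isRealWhittaker_realWhittaker (r : ℝ) (k : ℤ) :
    IsRealWhittaker r k (realWhittaker r k) (realWhittakerDeriv r k) :=
  (exists_isRealWhittaker r k).choose_spec

/-! ### Mellin transforms of products and integration by parts -/

/-- Continuous functions on `(0, ∞)` satisfying `WhittakerBound`. -/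
structure WhittakerClass (f : ℝ → ℂ) : Prop where
  continuousOn : ContinuousOn f (Set.Ioi 0)
  bound : WhittakerBound f

namespace WhittakerClass

variable {f g : ℝ → ℂ}

lemma add (hf : WhittakerClass f) (hg : WhittakerClass g) :
    WhittakerClass (fun y => f y + g y) :=
  ⟨hf.1.add hg.1, hf.2.add hg.2⟩

lemma const_mul (hf : WhittakerClass f) (c : ℂ) : WhittakerClass (fun y => c * f y) :=
  ⟨continuousOn_const.mul hf.1, hf.2.const_mul c⟩

lemma ofReal_mul (hf : WhittakerClass f) : WhittakerClass (fun y => (y : ℂ) * f y) :=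
  ⟨Complex.continuous_ofReal.continuousOn.mul hf.1, hf.2.ofReal_mul⟩

end WhittakerClass

lemma WhittakerBound.exists_norm_mul_cpow_le {f g : ℝ → ℂ} (hf : WhittakerBound f)
    (hg : WhittakerBound g) (σ : ℂ) : ∃ (C : ℝ) (n : ℕ), 0 ≤ C ∧ ∀ y : ℝ, 0 < y →
      ‖f y * g y * (y : ℂ) ^ σ‖ ≤
        C * (y ^ (3 / 4 + σ.re) * (1 + y) ^ n * Real.exp (-(1 / 2) * y)) := by
  obtain ⟨C, n, hC, hC'⟩ := hf
  obtain ⟨D, m, hD, hD'⟩ := hg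
  refine ⟨C * D, n + m, mul_nonneg hC hD, fun y hy => ?_⟩
  rw [norm_mul, norm_mul, Complex.norm_cpow_eq_rpow_re_of_pos hy]
  calc ‖f y‖ * ‖g y‖ * y ^ σ.re ≤ (C * (y ^ (3 / 8 : ℝ) * (1 + y) ^ n * Real.exp (-y / 4))) *
        (D * (y ^ (3 / 8 : ℝ) * (1 + y) ^ m * Real.exp (-y / 4))) * y ^ σ.re := by
        gcongr
        exacts [hC' y hy, hD' y hy]
    _ = C * D * ((y ^ (3 / 8 : ℝ) * y ^ (3 / 8 : ℝ) * y ^ σ.re) * (1 + y) ^ (n + m) *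
        (Real.exp (-y / 4) * Real.exp (-y / 4))) := by ring
    _ = _ := by
      rw [← Real.rpow_add hy, ← Real.rpow_add hy, ← Real.exp_add]
      congr 3
      · congr 2; norm_num
      · ring

lemma integrableOn_rpow_mul_one_add_pow_mul_exp {a : ℝ} (ha : -1 < a) (n : ℕ) :
    IntegrableOn (fun y : ℝ => y ^ a * (1 + y) ^ n * Real.exp (-(1 / 2) * y)) (Set.Ioi 0) := by
  have hi := fun b (hb : -1 < b) => integrableOn_rpow_mul_exp_neg_mul_rpow (s := b) (p := 1)
    (b := 1 / 2) hb one_pos (by norm_num)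
  induction n generalizing a with
  | zero => exact (hi a ha).congr_fun (fun y _ => by simp) measurableSet_Ioi
  | succ n ih =>
    refine ((ih ha).add (ih (a := a + 1) (by linarith))).congr_fun (fun y hy => ?_)
      measurableSet_Ioi
    rw [Pi.add_apply, Real.rpow_add_one (ne_of_gt hy)]
    ring

/-- The Mellin transform of a product. -/
noncomputable def mellinPair (f g : ℝ → ℂ) (σ : ℂ) : ℂ :=
  ∫ y in Set.Ioi (0 : ℝ), f y * g y * (y : ℂ) ^ (σ - 1)

section MellinPair

variable {f F g G : ℝ → ℂ} {σ : ℂ}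

/-- The exponent at 0 is at least 3/8 + 3/8 - 3/2 = -3/4 > -1. This gives the absolute convergence
in the theorem, where Re σ = -1/2. -/
lemma WhittakerClass.integrableOn (hf : WhittakerClass f) (hg : WhittakerClass g)
    (hσ : -1 / 2 ≤ σ.re) :
    IntegrableOn (fun y => f y * g y * (y : ℂ) ^ (σ - 1)) (Set.Ioi 0) := by
  obtain ⟨C, n, hC, h⟩ := hf.2.exists_norm_mul_cpow_le hg.2 (σ - 1)
  refine Integrable.mono' ((integrableOn_rpow_mul_one_add_pow_mul_exp
    (a := 3 / 4 + (σ - 1).re) (by simp; linarith) n).const_mul C) ?_ ?_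
  · refine ContinuousOn.aestronglyMeasurable ((hf.1.mul hg.1).mul fun y hy => ?_) measurableSet_Ioi
    exact (Complex.continuousAt_ofReal_cpow_const y _ (Or.inr (ne_of_gt hy))).continuousWithinAt
  · filter_upwards [ae_restrict_mem measurableSet_Ioi] with y hy using h y hy

lemma mellinPair_add_right (hf : WhittakerClass f) (hg : WhittakerClass g) (hG : WhittakerClass G)
    (hσ : -1 / 2 ≤ σ.re) :
    mellinPair f (fun y => g y + G y) σ = mellinPair f g σ + mellinPair f G σ := by
  rw [mellinPair, mellinPair, mellinPair,
    ← integral_add (hf.integrableOn hg hσ) (hf.integrableOn hG hσ)]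
  congr 1; ext y; ring

lemma mellinPair_const_mul_right (c : ℂ) :
    mellinPair f (fun y => c * g y) σ = c * mellinPair f g σ := by
  rw [mellinPair, mellinPair, ← integral_const_mul]
  congr 1; ext y; ring

lemma mellinPair_comm : mellinPair f g σ = mellinPair g f σ := by
  simp only [mellinPair, mul_comm (f _)]

lemma mellinPair_add_left (hf : WhittakerClass f) (hF : WhittakerClass F) (hg : WhittakerClass g)
    (hσ : -1 / 2 ≤ σ.re) :
    mellinPair (fun y => f y + F y) g σ = mellinPair f g σ + mellinPair F g σ := by
  rw [mellinPair_comm, mellinPair_add_right hg hf hF hσ, mellinPair_comm,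
    mellinPair_comm (g := F)]

lemma mellinPair_const_mul_left (c : ℂ) :
    mellinPair (fun y => c * f y) g σ = c * mellinPair f g σ := by
  rw [mellinPair_comm, mellinPair_const_mul_right, mellinPair_comm]

lemma mellinPair_sq_mul_left :
    mellinPair (fun y => (y : ℂ) * (y * f y)) g σ = mellinPair f g (σ + 2) := by
  refine setIntegral_congr_fun measurableSet_Ioi fun y hy => ?_
  have hy0 : (y : ℂ) ≠ 0 := by exact_mod_cast (ne_of_gt (Set.mem_Ioi.1 hy))
  simp only
  rw [show σ + 2 - 1 = σ - 1 + 2 by ring, Complex.cpow_add _ _ hy0, Complex.cpow_ofNat]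
  ring

/-- Integration by parts: `F` and `G` are `y f'` and `y g'`. -/
lemma mellinPair_by_parts (hf : WhittakerClass f) (hF : WhittakerClass F) (hg : WhittakerClass g)
    (hG : WhittakerClass G) (hfF : ∀ y, 0 < y → HasDerivAt f (F y / y) y)
    (hgG : ∀ y, 0 < y → HasDerivAt g (G y / y) y) (hσ : -1 / 2 ≤ σ.re) :
    mellinPair f G σ = -mellinPair F g σ - σ * mellinPair f g σ := by
  have hd : ∀ y : ℝ, 0 < y → HasDerivAt (fun y : ℝ => f y * g y * (y : ℂ) ^ σ)
      (F y * g y * (y : ℂ) ^ (σ - 1) + f y * G y * (y : ℂ) ^ (σ - 1) +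
        σ * (f y * g y * (y : ℂ) ^ (σ - 1))) y := fun y hy => by
    have hy0 : (y : ℂ) ≠ 0 := by exact_mod_cast hy.ne'
    have h1 : HasDerivAt (fun y : ℝ => (y : ℂ) ^ σ) (σ * (y : ℂ) ^ (σ - 1)) y := by
      have := ((hasDerivAt_id (y : ℂ)).cpow_const (c := σ)
        (Or.inl (by simpa using hy))).comp_ofReal
      simpa using this
    convert! ((hfF y hy).mul (hgG y hy)).mul h1 using 1
    simp only [Pi.mul_apply]
    rw [show (y : ℂ) ^ σ = (y : ℂ) ^ (σ - 1) * y by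
      rw [Complex.cpow_sub _ _ hy0, Complex.cpow_one, div_mul_cancel₀ _ hy0]]
    field_simp
  have i1 := hF.integrableOn hg hσ
  have i2 := hf.integrableOn hG hσ
  have i3 := (hf.integrableOn hg hσ).const_mul σ
  have i12 : IntegrableOn (fun y : ℝ => F y * g y * (y : ℂ) ^ (σ - 1) +
    f y * G y * (y : ℂ) ^ (σ - 1)) (Set.Ioi 0) := i1.add i2
  obtain ⟨C, n, hC, hb⟩ := hf.2.exists_norm_mul_cpow_le hg.2 σ
  have htop : Tendsto (fun y : ℝ => f y * g y * (y : ℂ) ^ σ) atTop (𝓝 0) := by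
    have := (tendsto_rpow_mul_one_add_pow_mul_exp_neg (3 / 4 + σ.re) n
      (b := 1 / 2) (by norm_num)).const_mul C
    rw [mul_zero] at this
    exact squeeze_zero_norm' ((eventually_gt_atTop 0).mono hb) this
  have hzero : Tendsto (fun y : ℝ => f y * g y * (y : ℂ) ^ σ) (𝓝[>] 0) (𝓝 0) := by
    have h1 : Tendsto (fun y : ℝ => C * (y ^ (3 / 4 + σ.re) * (1 + y) ^ n *
        Real.exp (-(1 / 2) * y))) (𝓝[>] 0) (𝓝 0) := by
      have hc : ContinuousAt (fun y : ℝ => C * (y ^ (3 / 4 + σ.re) * (1 + y) ^ n *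
          Real.exp (-(1 / 2) * y))) 0 := by
        have := Real.continuousAt_rpow_const 0 (3 / 4 + σ.re) (Or.inr (by linarith))
        fun_prop
      have := hc.tendsto.mono_left (nhdsWithin_le_nhds (s := Set.Ioi 0))
      rwa [Real.zero_rpow (by linarith), zero_mul, zero_mul, mul_zero] at this
    refine squeeze_zero_norm' ?_ h1
    filter_upwards [self_mem_nhdsWithin] with y hy using hb y hy
  -- The product tends to 0 at the origin because 3/4 + Re σ > 0, but its value there is arbitrary;
  -- it is reset to 0 for continuity at the endpoint.
  have key := integral_Ioi_of_hasDerivAt_of_tendsto (a := (0 : ℝ)) (m := (0 : ℂ))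
    (f := Function.update (fun y : ℝ => f y * g y * (y : ℂ) ^ σ) 0 0)
    (f' := fun y => F y * g y * (y : ℂ) ^ (σ - 1) + f y * G y * (y : ℂ) ^ (σ - 1) +
        σ * (f y * g y * (y : ℂ) ^ (σ - 1))) ?_ ?_ (i12.add i3) ?_
  · rw [integral_add i12 i3, integral_add i1 i2, integral_const_mul] at key
    simp only [Function.update_self, sub_zero] at key
    simp only [mellinPair]
    linear_combination key
  · rw [continuousWithinAt_update_same, Set.Ici_sdiff_left]
    exact hzero
  · intro y hy
    refine (hd y hy).congr_of_eventuallyEq ?_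
    filter_upwards [isOpen_Ioi.mem_nhds hy] with z hz
    exact Function.update_of_ne (ne_of_gt hz) _ _
  · refine htop.congr' ?_
    filter_upwards [eventually_gt_atTop 0] with y hy
    rw [Function.update_of_ne hy.ne']

end MellinPair

/-! ### The even combination and its recurrences -/

/-- `W_{k,ir} / Γ(1 / 2 + k - ir)`. -/
noncomputable def normalizedWhittaker (r : ℝ) (k : ℤ) (y : ℝ) : ℂ :=
  (Complex.Gamma (1 / 2 + k - Complex.I * r))⁻¹ * realWhittaker r k y

lemma half_add_sub_ne_zero (r : ℝ) (k : ℤ) : (1 / 2 + k - Complex.I * r : ℂ) ≠ 0 := by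
  intro h
  have h1 := congrArg Complex.re h
  simp only [Complex.sub_re, Complex.add_re, Complex.mul_re, Complex.I_re, Complex.I_im,
    Complex.ofReal_re, Complex.ofReal_im, Complex.intCast_re, Complex.zero_re] at h1
  norm_num at h1
  have h2 : (2 * k : ℝ) = -1 := by linarith
  have : 2 * k = -1 := by exact_mod_cast h2
  omega

lemma Gamma_half_add_one (r : ℝ) (k : ℤ) :
    Complex.Gamma (1 / 2 + ((k + 1 : ℤ) : ℂ) - Complex.I * r) =
      (1 / 2 + k - Complex.I * r) * Complex.Gamma (1 / 2 + k - Complex.I * r) := by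
  rw [← Complex.Gamma_add_one _ (half_add_sub_ne_zero r k)]
  congr 1
  push_cast
  ring

lemma whittakerClass_realWhittaker (r : ℝ) (k : ℤ) :
    WhittakerClass (fun y => (realWhittaker r k y : ℂ)) :=
  have h := isRealWhittaker_realWhittaker r k
  ⟨fun y hy => (h.hasDerivAt y hy).ofReal_comp.continuousAt.continuousWithinAt, h.bound.ofReal⟩

lemma whittakerClass_mul_realWhittakerDeriv (r : ℝ) (k : ℤ) :
    WhittakerClass (fun y => (y : ℂ) * (realWhittakerDeriv r k y : ℂ)) := by
  have h := isRealWhittaker_realWhittaker r k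
  refine ⟨fun y hy => ?_, ?_⟩
  · exact (Complex.continuous_ofReal.continuousAt.mul
      (h.hasDerivAt_deriv y hy).ofReal_comp.continuousAt).continuousWithinAt
  · exact h.bound_deriv.ofReal.congr fun y _ => by push_cast; rfl

lemma whittakerClass_normalizedWhittaker (r : ℝ) (k : ℤ) :
    WhittakerClass (normalizedWhittaker r k) :=
  (whittakerClass_realWhittaker r k).const_mul _

/-- The coefficient r² + (k - 1/2)² factors as (k - 1/2 + ir)(k - 1/2 - ir); the Gamma normalisation
absorbs one factor, leaving coefficients linear in r. -/
lemma hasDerivAt_normalizedWhittaker (r : ℝ) (k : ℤ) {y : ℝ} (hy : 0 < y) :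
    HasDerivAt (normalizedWhittaker r k)
      (1 / 2 * ((k - 1 / 2 + Complex.I * r) * normalizedWhittaker r (k - 1) y -
        (1 / 2 + k - Complex.I * r) * normalizedWhittaker r (k + 1) y) / y) y := by
  have h := isRealWhittaker_realWhittaker r
  have h1 := ((h k).hasDerivAt y hy).ofReal_comp.const_mul
    (Complex.Gamma (1 / 2 + k - Complex.I * r))⁻¹
  refine h1.congr_deriv ?_
  have hy0 : (y : ℂ) ≠ 0 := by exact_mod_cast hy.ne'
  have h2 := congrArg (fun x : ℝ => (x : ℂ))
    (IsRealWhittaker.two_mul_deriv (h (k - 1)) (h k) (h (k + 1)) hy)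
  push_cast at h2
  have ha := half_add_sub_ne_zero r k
  have hb := half_add_sub_ne_zero r (k - 1)
  have hg1 := Gamma_half_add_one r k
  have hg0 := Gamma_half_add_one r (k - 1)
  rw [sub_add_cancel] at hg0
  have hG : Complex.Gamma (1 / 2 + k - Complex.I * r) ≠ 0 := by
    refine Complex.Gamma_ne_zero fun m hm => half_add_sub_ne_zero r (k + m) ?_
    push_cast
    linear_combination hm
  have e : (r ^ 2 + (k - 1 / 2) ^ 2 : ℂ) =
      (k - 1 / 2 + Complex.I * r) * (1 / 2 + ((k - 1 : ℤ) : ℂ) - Complex.I * r) := by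
    push_cast
    linear_combination ((r : ℂ) ^ 2) * Complex.I_sq
  rw [e] at h2
  simp only [normalizedWhittaker, hg1]
  set A := Complex.Gamma (1 / 2 + k - Complex.I * r) with hA
  have hB : (Complex.Gamma (1 / 2 + ((k - 1 : ℤ) : ℂ) - Complex.I * r))⁻¹ =
      (1 / 2 + ((k - 1 : ℤ) : ℂ) - Complex.I * r) * A⁻¹ := by
    rw [hg0, mul_inv, mul_inv_cancel_left₀ hb]
  rw [hB, mul_inv, eq_div_iff hy0]
  calc A⁻¹ * (realWhittakerDeriv r k y : ℂ) * y
      = 1 / 2 * A⁻¹ * (2 * (y * (realWhittakerDeriv r k y : ℂ))) := by ring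
    _ = _ := by
      rw [h2]
      linear_combination (1 / 2 * A⁻¹ * (realWhittaker r (k + 1) y : ℂ)) * mul_inv_cancel₀ ha

/-- The even combination `W_{k,ir} / Γ(1 / 2 + k - ir) + W_{-k,ir} / Γ(1 / 2 - k - ir)`. -/
noncomputable def evenWhittaker (r : ℝ) (k : ℤ) (y : ℝ) : ℂ :=
  normalizedWhittaker r k y + normalizedWhittaker r (-k) y

lemma evenWhittaker_neg (r : ℝ) (k : ℤ) : evenWhittaker r (-k) = evenWhittaker r k := by
  funext y
  rw [evenWhittaker, evenWhittaker, neg_neg, add_comm]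

lemma whittakerClass_evenWhittaker (r : ℝ) (k : ℤ) : WhittakerClass (evenWhittaker r k) :=
  (whittakerClass_normalizedWhittaker r k).add (whittakerClass_normalizedWhittaker r (-k))

/-- Replacing k by -k exchanges the coefficients of the two neighbours, so the sum again satisfies a
closed relation. -/
lemma hasDerivAt_evenWhittaker (r : ℝ) (k : ℤ) {y : ℝ} (hy : 0 < y) :
    HasDerivAt (evenWhittaker r k)
      ((1 / 2 * (k - 1 / 2 + Complex.I * r) * evenWhittaker r (k - 1) y +
        -(1 / 2) * (1 / 2 + k - Complex.I * r) * evenWhittaker r (k + 1) y) / y) y := by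
  refine ((hasDerivAt_normalizedWhittaker r k hy).add
    (hasDerivAt_normalizedWhittaker r (-k) hy)).congr_deriv ?_
  simp only [evenWhittaker]
  rw [show -(k - 1) = -k + 1 by ring, show -(k + 1) = -k - 1 by ring]
  push_cast
  ring

/-- The Mellin transform of `W_{0,ir} S_k` with `S_k` the even combination. -/
noncomputable def evenMellin (r : ℝ) (k : ℤ) (σ : ℂ) : ℂ :=
  mellinPair (fun y => (realWhittaker r 0 y : ℂ)) (evenWhittaker r k) σ

/-- The Mellin transform of `y W_{0,ir}' S_k` with `S_k` the even combination. -/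
noncomputable def evenMellinDeriv (r : ℝ) (k : ℤ) (σ : ℂ) : ℂ :=
  mellinPair (fun y => (y : ℂ) * (realWhittakerDeriv r 0 y : ℂ)) (evenWhittaker r k) σ

section Recurrence

variable (r : ℝ) (k : ℤ) {σ : ℂ}

lemma hasDerivAt_realWhittaker {y : ℝ} (hy : 0 < y) :
    HasDerivAt (fun y => (realWhittaker r k y : ℂ))
      ((y : ℂ) * (realWhittakerDeriv r k y : ℂ) / y) y := by
  rw [mul_div_cancel_left₀ _ (by exact_mod_cast hy.ne')]
  exact ((isRealWhittaker_realWhittaker r k).hasDerivAt y hy).ofReal_comp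

lemma evenMellin_succ (hσ : -1 / 2 ≤ σ.re) :
    (1 / 2 + k - Complex.I * r) * evenMellin r (k + 1) σ =
      (k - 1 / 2 + Complex.I * r) * evenMellin r (k - 1) σ + 2 * evenMellinDeriv r k σ +
        2 * σ * evenMellin r k σ := by
  have h0 := whittakerClass_realWhittaker r 0
  have hp := (whittakerClass_evenWhittaker r (k - 1)).const_mul
    (1 / 2 * (k - 1 / 2 + Complex.I * r))
  have hn := (whittakerClass_evenWhittaker r (k + 1)).const_mul
    (-(1 / 2) * (1 / 2 + k - Complex.I * r))
  have := mellinPair_by_parts h0 (whittakerClass_mul_realWhittakerDeriv r 0)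
    (whittakerClass_evenWhittaker r k) (hp.add hn)
    (fun y hy => hasDerivAt_realWhittaker r 0 hy) (fun y hy => hasDerivAt_evenWhittaker r k hy) hσ
  rw [mellinPair_add_right h0 hp hn hσ, mellinPair_const_mul_right,
    mellinPair_const_mul_right] at this
  simp only [evenMellin, evenMellinDeriv]
  linear_combination -2 * this

/-- Differentiating y w_0' produces y² w_0'', which the equation replaces by (y²/4 - 1/4 - r²) w_0;
the term y²/4 is what shifts σ by 2. -/
lemma evenMellinDeriv_succ (hσ : -1 / 2 ≤ σ.re) :
    (1 / 2 + k - Complex.I * r) * evenMellinDeriv r (k + 1) σ =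
      (k - 1 / 2 + Complex.I * r) * evenMellinDeriv r (k - 1) σ +
        2 * (1 + σ) * evenMellinDeriv r k σ + 1 / 2 * evenMellin r k (σ + 2) -
        (1 / 2 + 2 * r ^ 2) * evenMellin r k σ := by
  have h0 := whittakerClass_realWhittaker r 0
  have h1 := whittakerClass_mul_realWhittakerDeriv r 0
  have hS := whittakerClass_evenWhittaker r k
  have hp := (whittakerClass_evenWhittaker r (k - 1)).const_mul
    (1 / 2 * (k - 1 / 2 + Complex.I * r))
  have hn := (whittakerClass_evenWhittaker r (k + 1)).const_mul
    (-(1 / 2) * (1 / 2 + k - Complex.I * r))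
  have h2 := h0.ofReal_mul.ofReal_mul.const_mul (1 / 4)
  have h3 := h0.const_mul (-(1 / 4 + r ^ 2))
  have hd : ∀ y : ℝ, 0 < y → HasDerivAt (fun y : ℝ => (y : ℂ) * (realWhittakerDeriv r 0 y : ℂ))
      (((y : ℂ) * (realWhittakerDeriv r 0 y : ℂ) +
        (1 / 4 * ((y : ℂ) * ((y : ℂ) * (realWhittaker r 0 y : ℂ))) +
          -(1 / 4 + (r : ℂ) ^ 2) * (realWhittaker r 0 y : ℂ))) / y) y := fun y hy => by
    have hy0 : (y : ℂ) ≠ 0 := by exact_mod_cast hy.ne'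
    have := ((hasDerivAt_id y).ofReal_comp).mul
      ((isRealWhittaker_realWhittaker r 0).hasDerivAt_deriv y hy).ofReal_comp
    convert! this using 1
    simp only [id]
    push_cast
    field_simp
    ring
  have := mellinPair_by_parts h1 (h1.add (h2.add h3)) hS (hp.add hn) hd
    (fun y hy => hasDerivAt_evenWhittaker r k hy) hσ
  rw [mellinPair_add_right h1 hp hn hσ, mellinPair_const_mul_right, mellinPair_const_mul_right,
    mellinPair_add_left h1 (h2.add h3) hS hσ, mellinPair_add_left h2 h3 hS hσ,
    mellinPair_const_mul_left, mellinPair_const_mul_left, mellinPair_sq_mul_left] at this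
  simp only [evenMellin, evenMellinDeriv]
  linear_combination -2 * this

/-- S_0 is a multiple of w_0 and w_0 w_0' = (w_0²)'/2, so one integration by parts determines the
transform. -/
lemma evenMellinDeriv_zero (hσ : -1 / 2 ≤ σ.re) :
    evenMellinDeriv r 0 σ = -(1 / 2) * σ * evenMellin r 0 σ := by
  have h0 := whittakerClass_realWhittaker r 0
  have h1 := whittakerClass_mul_realWhittakerDeriv r 0
  have hd := fun y hy => hasDerivAt_realWhittaker r 0 (y := y) hy
  have := mellinPair_by_parts h0 h1 h0 h1 hd hd hσ
  rw [mellinPair_comm] at this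
  have he : evenWhittaker r 0 = fun y => (2 * (Complex.Gamma (1 / 2 + (0 : ℤ) - Complex.I * r))⁻¹) *
      (realWhittaker r 0 y : ℂ) := by
    funext y
    rw [evenWhittaker, neg_zero, normalizedWhittaker]
    ring
  rw [evenMellin, evenMellinDeriv, he, mellinPair_const_mul_right, mellinPair_const_mul_right]
  linear_combination (Complex.Gamma (1 / 2 + (0 : ℤ) - Complex.I * r))⁻¹ * this

/-- The explicit evaluation of `evenMellin r 0`. -/
lemma evenMellin_zero {s : ℂ} (hs : 0 < s.re) :
    evenMellin r 0 (s - 1) = 2 * (Complex.Gamma (1 / 2 - Complex.I * r))⁻¹ *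
      (4 ^ (s - 1) / (2 * Real.pi) * (Complex.Gamma (s / 2) ^ 2 *
        Complex.Gamma (s / 2 + Complex.I * r) * Complex.Gamma (s / 2 - Complex.I * r) /
        Complex.Gamma s)) := by
  rw [← integral_whittakerZero_sq r hs, ← integral_const_mul, evenMellin, mellinPair]
  refine setIntegral_congr_fun measurableSet_Ioi fun y hy => ?_
  have := ((isRealWhittaker_realWhittaker r 0).eq_of_pos (isRealWhittaker_whittakerZero r) hy).1
  simp only [evenWhittaker, normalizedWhittaker, neg_zero, this, Int.cast_zero, add_zero]
  rw [show s - 1 - 1 = s - 2 by ring]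
  ring

/-- The functional equation of Γ in every factor. A shift of σ by 2 therefore costs about ρ². -/
lemma evenMellin_zero_add_two {s : ℂ} (hs : 0 < s.re) :
    (s + 1) * evenMellin r 0 (s - 1 + 2) = s * (s ^ 2 + 4 * r ^ 2) * evenMellin r 0 (s - 1) := by
  have hs2 : 0 < (s + 2).re := by simp; linarith
  have hne : ∀ z : ℂ, 0 < z.re → z ≠ 0 := fun z hz h => by rw [h] at hz; simp at hz
  rw [show s - 1 + 2 = s + 2 - 1 by ring, evenMellin_zero r hs, evenMellin_zero r hs2]
  have h1 : Complex.Gamma ((s + 2) / 2) = s / 2 * Complex.Gamma (s / 2) := by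
    rw [← Complex.Gamma_add_one _ (hne _ (by simp; exact hs))]; congr 1; ring
  have h2 : Complex.Gamma ((s + 2) / 2 + Complex.I * r) =
      (s / 2 + Complex.I * r) * Complex.Gamma (s / 2 + Complex.I * r) := by
    rw [← Complex.Gamma_add_one _ (hne _ (by simp; exact hs))]; congr 1; ring
  have h3 : Complex.Gamma ((s + 2) / 2 - Complex.I * r) =
      (s / 2 - Complex.I * r) * Complex.Gamma (s / 2 - Complex.I * r) := by
    rw [← Complex.Gamma_add_one _ (hne _ (by simp; exact hs))]; congr 1; ring
  have hs1 : s + 1 ≠ 0 := hne _ (by simp; linarith)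
  have h4 : Complex.Gamma (s + 2) = (s + 1) * (s * Complex.Gamma s) := by
    rw [← Complex.Gamma_add_one _ (hne _ hs), ← Complex.Gamma_add_one _ hs1]; congr 1; ring
  have h5 : (4 : ℂ) ^ (s + 2 - 1) = 16 * 4 ^ (s - 1) := by
    rw [show s + 2 - 1 = s - 1 + 2 by ring, Complex.cpow_add _ _ (by norm_num), Complex.cpow_ofNat]
    norm_num
    ring
  have hG := Complex.Gamma_ne_zero_of_re_pos hs
  have hs0 := hne s hs
  have e : (s ^ 2 + 4 * r ^ 2 : ℂ) = 4 * ((s / 2 + Complex.I * r) * (s / 2 - Complex.I * r)) := by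
    linear_combination (4 * (r : ℂ) ^ 2) * Complex.I_sq
  rw [h1, h2, h3, h4, h5, e]
  field_simp
  ring

end Recurrence

/-! ### Bounds uniform in r and t, by induction on k -/

section Bounds

variable (r t : ℝ)

/-- The real part is at least 1/2 and the imaginary part is -r, so three times the norm is at least
1 + |r|. -/
lemma norm_half_add_sub_ge (k : ℕ) : (1 + |r|) / 3 ≤ ‖(1 / 2 + (k : ℤ) - Complex.I * r : ℂ)‖ := by
  have h1 := Complex.abs_re_le_norm (1 / 2 + (k : ℤ) - Complex.I * r : ℂ)
  have h2 := Complex.abs_im_le_norm (1 / 2 + (k : ℤ) - Complex.I * r : ℂ)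
  have e1 : (1 / 2 + (k : ℤ) - Complex.I * r : ℂ).re = 1 / 2 + k := by simp
  have e2 : (1 / 2 + (k : ℤ) - Complex.I * r : ℂ).im = -r := by simp
  rw [e1, abs_of_pos (by positivity)] at h1
  rw [e2, abs_neg] at h2
  linarith [Nat.cast_nonneg (α := ℝ) k]

lemma norm_sub_half_add_le (k : ℕ) :
    ‖((k : ℤ) - 1 / 2 + Complex.I * r : ℂ)‖ ≤ (k + 1) * (1 + |r|) := by
  calc ‖((k : ℤ) - 1 / 2 + Complex.I * r : ℂ)‖ ≤ ‖((k : ℤ) : ℂ)‖ + ‖(1 / 2 : ℂ)‖ +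
        ‖Complex.I * (r : ℂ)‖ := (norm_add_le _ _).trans (add_le_add (norm_sub_le _ _) le_rfl)
    _ = k + 1 / 2 + |r| := by simp
    _ ≤ _ := by nlinarith [abs_nonneg r, Nat.cast_nonneg (α := ℝ) k]

lemma norm_mellinPoint_le (j : ℕ) :
    ‖(-(1 / 2) + Complex.I * t + 2 * j : ℂ)‖ ≤ (2 * j + 1) * (1 + |r| + |t|) := by
  calc ‖(-(1 / 2) + Complex.I * t + 2 * j : ℂ)‖ ≤ ‖(-(1 / 2) : ℂ)‖ + ‖Complex.I * (t : ℂ)‖ +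
        ‖(2 * j : ℂ)‖ := norm_add₃_le
    _ = 1 / 2 + |t| + 2 * j := by simp
    _ ≤ _ := by nlinarith [abs_nonneg r, abs_nonneg t, Nat.cast_nonneg (α := ℝ) j]

lemma norm_evenMellin_zero_le (j : ℕ) : ∃ C : ℝ, 0 ≤ C ∧ ∀ r t : ℝ,
    ‖evenMellin r 0 (-(1 / 2) + Complex.I * t + 2 * j)‖ ≤
      C * (1 + |r| + |t|) ^ (2 * j) * ‖evenMellin r 0 (-(1 / 2) + Complex.I * t)‖ := by
  induction j with
  | zero => exact ⟨1, zero_le_one, fun r t => by simp⟩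
  | succ j ih =>
    obtain ⟨C, hC, h⟩ := ih
    refine ⟨((2 * j + 2) ^ 2 + 4) * C, by positivity, fun r t => ?_⟩
    have hj : (0 : ℝ) ≤ j := Nat.cast_nonneg j
    set s : ℂ := 1 / 2 + Complex.I * t + 2 * j with hs
    have hsre : s.re = 1 / 2 + 2 * j := by simp [hs]
    have hrec := evenMellin_zero_add_two r (s := s) (by rw [hsre]; positivity)
    have e1 : s - 1 = -(1 / 2) + Complex.I * t + 2 * j := by rw [hs]; ring
    have e2 : -(1 / 2) + Complex.I * t + 2 * ((j + 1 : ℕ) : ℂ) = s - 1 + 2 := by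
      rw [hs]; push_cast; ring
    rw [e2]
    have h0 := h r t
    rw [← e1] at h0
    have hs1 : ‖s‖ ≤ ‖s + 1‖ := by
      refine le_of_pow_le_pow_left₀ two_ne_zero (norm_nonneg _) ?_
      rw [Complex.sq_norm, Complex.sq_norm, Complex.normSq_apply, Complex.normSq_apply]
      simp only [Complex.add_re, Complex.one_re, Complex.add_im, Complex.one_im, hsre]
      nlinarith
    have hspos : 0 < ‖s + 1‖ := by
      refine lt_of_lt_of_le ?_ (Complex.re_le_norm _)
      simp only [Complex.add_re, Complex.one_re, hsre]
      positivity
    set ρ := 1 + |r| + |t| with hρ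
    have hρ1 : 1 ≤ ρ := by rw [hρ]; linarith [abs_nonneg r, abs_nonneg t]
    have hsn : ‖s‖ ≤ (2 * j + 2) * ρ := by
      have h1 := norm_mellinPoint_le r t j
      rw [← e1] at h1
      calc ‖s‖ = ‖s - 1 + 1‖ := by rw [sub_add_cancel]
        _ ≤ ‖s - 1‖ + ‖(1 : ℂ)‖ := norm_add_le _ _
        _ ≤ (2 * j + 1) * ρ + 1 := by rw [norm_one]; linarith
        _ ≤ _ := by linarith
    have hq : ‖s ^ 2 + 4 * (r : ℂ) ^ 2‖ ≤ ((2 * j + 2) ^ 2 + 4) * ρ ^ 2 := by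
      calc ‖s ^ 2 + 4 * (r : ℂ) ^ 2‖ ≤ ‖s‖ ^ 2 + 4 * |r| ^ 2 :=
            (norm_add_le _ _).trans_eq (by simp)
        _ ≤ ((2 * j + 2) * ρ) ^ 2 + 4 * ρ ^ 2 := by
          gcongr
          rw [hρ]; linarith [abs_nonneg t]
        _ = _ := by ring
    refine le_of_mul_le_mul_left ?_ hspos
    calc ‖s + 1‖ * ‖evenMellin r 0 (s - 1 + 2)‖
        = ‖s‖ * ‖s ^ 2 + 4 * (r : ℂ) ^ 2‖ * ‖evenMellin r 0 (s - 1)‖ := by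
          rw [← norm_mul, hrec, norm_mul, norm_mul]
      _ ≤ ‖s + 1‖ * (((2 * j + 2) ^ 2 + 4) * ρ ^ 2) *
          (C * ρ ^ (2 * j) * ‖evenMellin r 0 (-(1 / 2) + Complex.I * t)‖) := by gcongr
      _ = _ := by ring

/-- The common shape of the bounds for the transforms `evenMellin r k` and `evenMellinDeriv r k`. -/
def EvenMellinBound (k : ℕ) : Prop :=
  ∀ j : ℕ, ∃ C : ℝ, 0 ≤ C ∧ ∀ r t : ℝ,
    ‖evenMellin r k (-(1 / 2) + Complex.I * t + 2 * j)‖ ≤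
      C * (((1 + |r| + |t|) / (1 + |r|)) ^ k * (1 + |r| + |t|) ^ (2 * j) *
        ‖evenMellin r 0 (-(1 / 2) + Complex.I * t)‖) ∧
    ‖evenMellinDeriv r k (-(1 / 2) + Complex.I * t + 2 * j)‖ ≤
      C * (((1 + |r| + |t|) / (1 + |r|)) ^ k * (1 + |r| + |t|) ^ (2 * j + 1) *
        ‖evenMellin r 0 (-(1 / 2) + Complex.I * t)‖)

lemma neg_half_le_re_mellinPoint (j : ℕ) : -1 / 2 ≤ (-(1 / 2) + Complex.I * t + 2 * j : ℂ).re := by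
  have : (-(1 / 2) + Complex.I * t + 2 * j : ℂ).re = -(1 / 2) + 2 * j := by simp
  rw [this]
  linarith [Nat.cast_nonneg (α := ℝ) j]

lemma evenMellinBound_zero : EvenMellinBound 0 := by
  intro j
  obtain ⟨C, hC, h⟩ := norm_evenMellin_zero_le j
  refine ⟨(2 * j + 1) * C, by positivity, fun r t => ⟨?_, ?_⟩⟩
  · have h1 : C ≤ (2 * j + 1) * C := by nlinarith [Nat.cast_nonneg (α := ℝ) j]
    refine (h r t).trans ?_
    rw [pow_zero, one_mul, mul_assoc]
    gcongr
  · have h1 := norm_mellinPoint_le r t j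
    rw [Nat.cast_zero, evenMellinDeriv_zero r (neg_half_le_re_mellinPoint t j), norm_mul, norm_mul]
    have h2 : ‖(-(1 / 2) : ℂ)‖ ≤ 1 := by norm_num
    calc _ ≤ 1 * ((2 * j + 1) * (1 + |r| + |t|)) * (C * (1 + |r| + |t|) ^ (2 * j) *
          ‖evenMellin r 0 (-(1 / 2) + Complex.I * t)‖) := by
          gcongr
          exact h r t
      _ = _ := by ring

/-- Used with q = 1 + |r|, the common order of the coefficients a and b. -/
lemma norm_le_of_recurrence {a b c e x y : ℂ} {q K A : ℝ} (hq : 0 < q) (ha : q / 3 ≤ ‖a‖)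
    (hb : ‖b‖ ≤ K * q) (he : ‖e‖ ≤ 1) (hA : ‖y‖ ≤ q * A) (h : a * x = b * c + e * y) :
    ‖x‖ ≤ 3 * (K * ‖c‖ + A) := by
  have h1 : q / 3 * ‖x‖ ≤ q * (K * ‖c‖ + A) := by
    calc q / 3 * ‖x‖ ≤ ‖a‖ * ‖x‖ := by gcongr
      _ = ‖b * c + e * y‖ := by rw [← norm_mul, h]
      _ ≤ ‖b‖ * ‖c‖ + ‖e‖ * ‖y‖ := (norm_add_le _ _).trans_eq (by rw [norm_mul, norm_mul])
      _ ≤ K * q * ‖c‖ + 1 * (q * A) := by gcongr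
      _ = _ := by ring
  have : q * ‖x‖ ≤ q * (3 * (K * ‖c‖ + A)) := by linarith
  exact le_of_mul_le_mul_left this hq

/-- `V`, `V'` and `e` cover two cases: the transforms of index k - 1 with e = 1, and, for k = 0,
zero with e = 1/2. The bound for all j is carried along because N_{k+1}(σ) involves M_k(σ + 2). -/
lemma EvenMellinBound.step {k : ℕ} (hk : EvenMellinBound k) (V V' : ℝ → ℂ → ℂ) {e : ℂ}
    (he : ‖e‖ ≤ 1)
    (hV : ∀ (r : ℝ) (σ : ℂ), -1 / 2 ≤ σ.re →
      (1 / 2 + (k : ℤ) - Complex.I * r) * evenMellin r (k + 1) σ =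
        ((k : ℤ) - 1 / 2 + Complex.I * r) * V r σ +
          e * (2 * evenMellinDeriv r k σ + 2 * σ * evenMellin r k σ))
    (hV' : ∀ (r : ℝ) (σ : ℂ), -1 / 2 ≤ σ.re →
      (1 / 2 + (k : ℤ) - Complex.I * r) * evenMellinDeriv r (k + 1) σ =
        ((k : ℤ) - 1 / 2 + Complex.I * r) * V' r σ +
          e * (2 * (1 + σ) * evenMellinDeriv r k σ + 1 / 2 * evenMellin r k (σ + 2) +
            -((1 / 2 + 2 * r ^ 2) * evenMellin r k σ)))
    (hp : ∀ j : ℕ, ∃ (D : ℝ), 0 ≤ D ∧ ∀ r t : ℝ,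
      ‖V r (-(1 / 2) + Complex.I * t + 2 * j)‖ ≤
      D * (((1 + |r| + |t|) / (1 + |r|)) ^ (k + 1) * (1 + |r| + |t|) ^ (2 * j) *
        ‖evenMellin r 0 (-(1 / 2) + Complex.I * t)‖) ∧
      ‖V' r (-(1 / 2) + Complex.I * t + 2 * j)‖ ≤
      D * (((1 + |r| + |t|) / (1 + |r|)) ^ (k + 1) * (1 + |r| + |t|) ^ (2 * j + 1) *
        ‖evenMellin r 0 (-(1 / 2) + Complex.I * t)‖)) : EvenMellinBound (k + 1) := by
  intro j
  obtain ⟨D, hD, h0⟩ := hp j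
  obtain ⟨C, hC, h1⟩ := hk j
  obtain ⟨C', hC', h2⟩ := hk (j + 1)
  have hj : (0 : ℝ) ≤ j := Nat.cast_nonneg j
  refine ⟨3 * ((k + 1) * D + ((4 * j + 6) * C + C')), by positivity, fun r t => ?_⟩
  obtain ⟨hU, hX⟩ := h1 r t
  obtain ⟨hU', -⟩ := h2 r t
  obtain ⟨hp0, hp1⟩ := h0 r t
  have hr0 := abs_nonneg r
  have ht0 := abs_nonneg t
  have e2 : -(1 / 2) + Complex.I * t + 2 * ((j + 1 : ℕ) : ℂ) =
      -(1 / 2) + Complex.I * t + 2 * j + 2 := by push_cast; ring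
  rw [e2] at hU'
  have ha := norm_half_add_sub_ge r k
  have hb := norm_sub_half_add_le r k
  have hre := neg_half_le_re_mellinPoint t j
  have hσn := norm_mellinPoint_le r t j
  have hr2 : ‖(1 / 2 + 2 * (r : ℂ) ^ 2)‖ ≤ 2 * (1 + |r| + |t|) ^ 2 := by
    refine (norm_add_le _ _).trans ?_
    have : ‖(2 * (r : ℂ) ^ 2)‖ = 2 * |r| ^ 2 := by simp
    rw [this]
    have h3 : ‖(1 / 2 : ℂ)‖ = 1 / 2 := by norm_num
    have h4 : (1 + |r|) ^ 2 ≤ (1 + |r| + |t|) ^ 2 :=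
      pow_le_pow_left₀ (by positivity) (by linarith) 2
    rw [h3]
    linarith [sq_nonneg |r|, h4, add_sq 1 |r|]
  have hrec := hV r _ hre
  have hrec' := hV' r _ hre
  have hq : 0 < 1 + |r| := by positivity
  have hρ1 : 1 ≤ 1 + |r| + |t| := by linarith
  have hLq : 1 + |r| + |t| = (1 + |r|) * ((1 + |r| + |t|) / (1 + |r|)) := by field_simp
  have hL0 : 0 ≤ (1 + |r| + |t|) / (1 + |r|) := by positivity
  have hB0 : 0 ≤ ‖evenMellin r 0 (-(1 / 2) + Complex.I * t)‖ := norm_nonneg _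
  push_cast
  -- What remains is bookkeeping with ρ = qL: the factor ρ lost in the recurrence is q, cancelled by
  -- the coefficient on the left, times L, which raises the exponent of L to k + 1.
  generalize ‖evenMellin r 0 (-(1 / 2) + Complex.I * t)‖ = B at *
  generalize (-(1 / 2) + Complex.I * t + 2 * j : ℂ) = σ at *
  generalize (1 + |r| + |t|) / (1 + |r|) = L at *
  generalize 1 + |r| + |t| = ρ at *
  generalize 1 + |r| = q at *
  have hσ1n : ‖1 + σ‖ ≤ (2 * j + 2) * ρ := by
    refine (norm_add_le _ _).trans ?_
    rw [norm_one]
    linarith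
  have hhalf : ‖(1 / 2 : ℂ)‖ ≤ 1 := by norm_num
  have hk0 : (0 : ℝ) ≤ k + 1 := by positivity
  constructor
  · refine (norm_le_of_recurrence (A := (4 * j + 4) * C * (L ^ (k + 1) * ρ ^ (2 * j) * B))
      hq ha hb he ?_ hrec).trans ?_
    · calc _ ≤ 2 * ‖evenMellinDeriv r k σ‖ + 2 * ‖σ‖ * ‖evenMellin r k σ‖ :=
            (norm_add_le _ _).trans_eq (by simp)
        _ ≤ 2 * (C * (L ^ k * ρ ^ (2 * j + 1) * B)) +
            2 * ((2 * j + 1) * ρ) * (C * (L ^ k * ρ ^ (2 * j) * B)) := by gcongr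
        _ = (4 * j + 4) * C * (L ^ k * ρ ^ (2 * j) * B) * ρ := by ring
        _ = (4 * j + 4) * C * (L ^ k * ρ ^ (2 * j) * B) * (q * L) := by rw [← hLq]
        _ = _ := by ring
    · have h3 : (4 * j + 4) * C * (L ^ (k + 1) * ρ ^ (2 * j) * B) ≤
          ((4 * j + 6) * C + C') * (L ^ (k + 1) * ρ ^ (2 * j) * B) := by
        gcongr
        linarith
      have h4 := mul_le_mul_of_nonneg_left hp0 hk0
      linarith
  · refine (norm_le_of_recurrence
      (A := ((4 * j + 6) * C + C') * (L ^ (k + 1) * ρ ^ (2 * j + 1) * B))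
      hq ha hb he ?_ hrec').trans ?_
    · calc _ ≤ 2 * ‖1 + σ‖ * ‖evenMellinDeriv r k σ‖ + ‖(1 / 2 : ℂ)‖ * ‖evenMellin r k (σ + 2)‖ +
            ‖(1 / 2 + 2 * (r : ℂ) ^ 2)‖ * ‖evenMellin r k σ‖ :=
            norm_add₃_le.trans_eq (by simp only [norm_mul, norm_neg, Complex.norm_ofNat])
        _ ≤ 2 * ((2 * j + 2) * ρ) * (C * (L ^ k * ρ ^ (2 * j + 1) * B)) +
            1 * (C' * (L ^ k * ρ ^ (2 * (j + 1)) * B)) +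
            2 * ρ ^ 2 * (C * (L ^ k * ρ ^ (2 * j) * B)) := by gcongr
        _ = ((4 * j + 6) * C + C') * (L ^ k * ρ ^ (2 * j + 1) * B) * ρ := by ring
        _ = ((4 * j + 6) * C + C') * (L ^ k * ρ ^ (2 * j + 1) * B) * (q * L) := by rw [← hLq]
        _ = _ := by ring
    · have h4 := mul_le_mul_of_nonneg_left hp1 hk0
      linarith

lemma evenMellin_neg (k : ℤ) (σ : ℂ) : evenMellin r (-k) σ = evenMellin r k σ := by
  rw [evenMellin, evenWhittaker_neg, evenMellin]

lemma evenMellinDeriv_neg (k : ℤ) (σ : ℂ) : evenMellinDeriv r (-k) σ = evenMellinDeriv r k σ := by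
  rw [evenMellinDeriv, evenWhittaker_neg, evenMellinDeriv]

/-- The recurrence has order two, so consecutive bounds are propagated. At k = 0 the terms of index
1 and -1 coincide and have opposite coefficients ±(1/2 - ir); collecting them doubles the left side,
whence e = 1/2. -/
theorem evenMellinBound (k : ℕ) : EvenMellinBound k := by
  suffices h : EvenMellinBound k ∧ EvenMellinBound (k + 1) from h.1
  induction k with
  | zero =>
    refine ⟨evenMellinBound_zero, evenMellinBound_zero.step 0 0 (e := 1 / 2) (by norm_num)
      (fun r σ hσ => ?_) (fun r σ hσ => ?_) fun j => ⟨0, le_rfl, fun r t => by simp⟩⟩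
    · have h := evenMellin_succ r 0 hσ
      rw [zero_sub, zero_add, evenMellin_neg] at h
      simp only [Nat.cast_zero, Int.cast_zero, zero_add, Pi.zero_apply, mul_zero] at h ⊢
      linear_combination (1 / 2) * h
    · have h := evenMellinDeriv_succ r 0 hσ
      rw [zero_sub, zero_add, evenMellinDeriv_neg] at h
      simp only [Nat.cast_zero, Int.cast_zero, zero_add, Pi.zero_apply, mul_zero] at h ⊢
      linear_combination (1 / 2) * h
  | succ k ih =>
    refine ⟨ih.2, ih.2.step (fun r σ => evenMellin r k σ) (fun r σ => evenMellinDeriv r k σ)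
      (e := 1) (by norm_num) (fun r σ hσ => ?_) (fun r σ hσ => ?_) fun j => ?_⟩
    · rw [evenMellin_succ r ((k + 1 : ℕ) : ℤ) hσ]
      push_cast
      rw [add_sub_cancel_right]
      ring
    · rw [evenMellinDeriv_succ r ((k + 1 : ℕ) : ℤ) hσ]
      push_cast
      rw [add_sub_cancel_right]
      ring
    · obtain ⟨C, hC, h⟩ := ih.1 j
      refine ⟨C, hC, fun r t => ?_⟩
      have hL : 1 ≤ (1 + |r| + |t|) / (1 + |r|) := by
        rw [one_le_div (by positivity)]
        linarith [abs_nonneg t]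
      refine ⟨(h r t).1.trans ?_, (h r t).2.trans ?_⟩ <;>
      · gcongr
        omega

end Bounds

/-! ### The Whittaker integral -/

lemma whittakerIntegrand_eq (k : ℤ) (r t : ℝ) {y : ℝ} (hy : 0 < y) :
    whittakerIntegrand k r (-r) t y = (Complex.Gamma (1 / 2 + Complex.I * r))⁻¹ *
      ((realWhittaker r 0 y : ℂ) * evenWhittaker r k y *
        (y : ℂ) ^ ((-(1 / 2) + Complex.I * t : ℂ) - 1)) := by
  have hμ : (Complex.I * r) ^ 2 = -(r : ℂ) ^ 2 := by rw [mul_pow, Complex.I_sq]; ring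
  have hμ' : (Complex.I * ((-r : ℝ) : ℂ)) ^ 2 = -(r : ℂ) ^ 2 := by
    rw [mul_pow, Complex.I_sq]; push_cast; ring
  have h := isRealWhittaker_realWhittaker r
  have h0 := (h 0).whittakerW_eq hμ hy
  have hk := (h k).whittakerW_eq hμ' hy
  have hk' := (h (-k)).whittakerW_eq hμ' hy
  rw [Int.cast_zero] at h0
  rw [Int.cast_neg] at hk'
  have hy0 : (y : ℂ) ≠ 0 := by exact_mod_cast hy.ne'
  rw [whittakerIntegrand, h0, hk, hk', Complex.cpow_sub _ _ hy0, Complex.cpow_one, evenWhittaker,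
    normalizedWhittaker, normalizedWhittaker]
  push_cast
  rw [show (1 / 2 + (k : ℂ) + Complex.I * -r) = 1 / 2 + k - Complex.I * r by ring,
    show (1 / 2 - (k : ℂ) + Complex.I * -r) = 1 / 2 + -k - Complex.I * r by ring]
  ring

lemma integrableOn_whittakerIntegrand (k : ℤ) (r t : ℝ) :
    IntegrableOn (whittakerIntegrand k r (-r) t) (Set.Ioi (0 : ℝ)) := by
  have h := ((whittakerClass_realWhittaker r 0).integrableOn (whittakerClass_evenWhittaker r k)
    (σ := -(1 / 2) + Complex.I * t) (by simp; norm_num)).const_mul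
    (Complex.Gamma (1 / 2 + Complex.I * r))⁻¹
  exact IntegrableOn.congr_fun h (fun y hy => (whittakerIntegrand_eq k r t hy).symm)
    measurableSet_Ioi

lemma whittakerIntegral_eq (k : ℤ) (r t : ℝ) :
    whittakerIntegral k r (-r) t = (Complex.Gamma (1 / 2 + Complex.I * r))⁻¹ *
      evenMellin r k (-(1 / 2) + Complex.I * t) := by
  rw [whittakerIntegral, evenMellin, mellinPair, ← integral_const_mul]
  exact setIntegral_congr_fun measurableSet_Ioi fun y hy => whittakerIntegrand_eq k r t hy

/-- With e as below, |t| ≤ e + 2|r| gives the ratio at most 3 + e, while the exponential is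
exp(-(π/2) e) ≤ exp(-e); any power of 3 + e is absorbed. -/
lemma exists_pow_mul_exp_le (n : ℕ) : ∃ C : ℝ, 0 < C ∧ ∀ r t : ℝ,
    ((1 + |r| + |t|) / (1 + |r|)) ^ n *
      Real.exp (Real.pi * |r| - Real.pi / 2 * (|t / 2 + r| + |t / 2 - r|)) ≤ C := by
  refine ⟨n.factorial * Real.exp 3, by positivity, fun r t => ?_⟩
  set e := |t / 2 + r| + |t / 2 - r| - 2 * |r| with he
  have h1 : 2 * |r| ≤ |t / 2 + r| + |t / 2 - r| := by
    have := abs_sub (t / 2 + r) (t / 2 - r)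
    rw [show t / 2 + r - (t / 2 - r) = 2 * r by ring, abs_mul, abs_two] at this
    exact this
  have h2 : |t| ≤ |t / 2 + r| + |t / 2 - r| := by
    have := abs_add_le (t / 2 + r) (t / 2 - r)
    rwa [show t / 2 + r + (t / 2 - r) = t by ring] at this
  have he0 : 0 ≤ e := by rw [he]; linarith
  have hr := abs_nonneg r
  have h3 : (1 + |r| + |t|) / (1 + |r|) ≤ 3 + e := by
    rw [div_le_iff₀ (by positivity)]
    nlinarith [mul_nonneg he0 hr]
  have h4 := Real.pow_div_factorial_le_exp (3 + e) (by positivity) n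
  rw [div_le_iff₀ (by positivity)] at h4
  calc _ ≤ (3 + e) ^ n * Real.exp (-e) := by
        gcongr
        rw [show Real.pi * |r| - Real.pi / 2 * (|t / 2 + r| + |t / 2 - r|) = -(Real.pi / 2 * e) by
          rw [he]; ring]
        nlinarith [Real.pi_gt_three]
    _ ≤ Real.exp (3 + e) * n.factorial * Real.exp (-e) := by gcongr
    _ = n.factorial * (Real.exp (3 + e) * Real.exp (-e)) := by ring
    _ = _ := by rw [← Real.exp_add]; congr 2; ring

lemma one_add_abs_half_rpow_le {p : ℝ} (hp : 0 ≤ p) (hp1 : p ≤ 1) {x z : ℝ} (hx : 2 * |x| = |z|) :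
    (1 + |x|) ^ (-p) ≤ 2 * (1 + |z|) ^ (-p) := by
  have hz := abs_nonneg z
  have h1 : (1 + |x|) ^ (-p) ≤ ((1 + |z|) / 2) ^ (-p) :=
    Real.rpow_le_rpow_of_nonpos (by positivity) (by linarith) (by linarith)
  refine h1.trans ?_
  rw [Real.div_rpow (by positivity) two_pos.le, Real.rpow_neg two_pos.le, div_inv_eq_mul, mul_comm]
  gcongr
  exact (Real.rpow_le_rpow_of_exponent_le one_le_two hp1).trans_eq (Real.rpow_one 2)

/-- At s = 1/2 + it the numerator Gamma factors all lie on Re z = 1/4. Γ(s/2)² gives (1 +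
|t|)^{-1/2} and a decay e^{-π|t|/2} that cancels the growth of 1/Γ(s); Γ(s/2 ± ir) give the other
two algebraic factors and the remaining exponential. -/
lemma exists_norm_evenMellin_zero_le : ∃ C : ℝ, 0 < C ∧ ∀ r t : ℝ,
    ‖evenMellin r 0 (-(1 / 2) + Complex.I * t)‖ ≤
      ‖Complex.Gamma (1 / 2 + Complex.I * r)‖⁻¹ * (C * ((1 + |t|) ^ (-(1 / 2) : ℝ) *
        (1 + |2 * r + t|) ^ (-(1 / 4) : ℝ) * (1 + |2 * r - t|) ^ (-(1 / 4) : ℝ) *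
        Real.exp (-(Real.pi / 2) * (|t / 2 + r| + |t / 2 - r|)))) := by
  obtain ⟨K, hK, h⟩ := exists_norm_Gamma_quarter_le
  refine ⟨16 * K ^ 4, by positivity, fun r t => ?_⟩
  have hpi := Real.pi_pos
  set s : ℂ := 1 / 2 + Complex.I * t with hs
  have hsre : s.re = 1 / 2 := by simp [hs]
  have e0 : -(1 / 2) + Complex.I * t = s - 1 := by rw [hs]; ring
  rw [e0, evenMellin_zero r (s := s) (by rw [hsre]; norm_num)]
  have e1 : s / 2 = 1 / 4 + Complex.I * ((t / 2 : ℝ) : ℂ) := by rw [hs]; push_cast; ring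
  have e2 : s / 2 + Complex.I * r = 1 / 4 + Complex.I * ((t / 2 + r : ℝ) : ℂ) := by
    rw [hs]; push_cast; ring
  have e3 : s / 2 - Complex.I * r = 1 / 4 + Complex.I * ((t / 2 - r : ℝ) : ℂ) := by
    rw [hs]; push_cast; ring
  have h4 : ‖(4 : ℂ) ^ (s - 1) / (2 * Real.pi)‖ ≤ 1 := by
    have : ‖(4 : ℂ) ^ (s - 1)‖ ≤ 1 := by
      have := Complex.norm_cpow_eq_rpow_re_of_pos (x := 4) (by norm_num) (s - 1)
      rw [Complex.ofReal_ofNat] at this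
      rw [this]
      exact Real.rpow_le_one_of_one_le_of_nonpos (by norm_num) (by simp [hsre]; norm_num)
    rw [norm_div, norm_mul, Complex.norm_ofNat, Complex.norm_of_nonneg hpi.le]
    exact (div_le_self (norm_nonneg _) (by linarith [Real.pi_gt_three])).trans this
  have g1 := h (t / 2)
  have g2 := h (t / 2 + r)
  have g3 := h (t / 2 - r)
  have g4 := inv_norm_Gamma_half_le t
  rw [← hs] at g4
  rw [← e1] at g1
  rw [← e2] at g2
  rw [← e3] at g3
  have p1 : ((1 + |t / 2|) ^ (-(1 / 4) : ℝ)) ^ 2 ≤ 2 * (1 + |t|) ^ (-(1 / 2) : ℝ) := by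
    rw [← Real.rpow_natCast, ← Real.rpow_mul (by positivity),
      show (-(1 / 4) * ((2 : ℕ) : ℝ) : ℝ) = -(1 / 2) by norm_num]
    exact one_add_abs_half_rpow_le (by norm_num) (by norm_num) (by
      rw [abs_div, abs_two]; ring)
  have p2 : (1 + |t / 2 + r|) ^ (-(1 / 4) : ℝ) ≤ 2 * (1 + |2 * r + t|) ^ (-(1 / 4) : ℝ) :=
    one_add_abs_half_rpow_le (by norm_num) (by norm_num) (by
      rw [show 2 * r + t = 2 * (t / 2 + r) by ring, abs_mul, abs_two])
  have p3 : (1 + |t / 2 - r|) ^ (-(1 / 4) : ℝ) ≤ 2 * (1 + |2 * r - t|) ^ (-(1 / 4) : ℝ) :=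
    one_add_abs_half_rpow_le (by norm_num) (by norm_num) (by
      rw [show 2 * r - t = -(2 * (t / 2 - r)) by ring, abs_neg, abs_mul, abs_two])
  have ht2 : 2 * |t / 2| = |t| := by rw [abs_div, abs_two]; ring
  rw [norm_mul, norm_mul, norm_inv, norm_Gamma_half_sub, Complex.norm_ofNat, norm_mul, norm_div (_ * _ * _),
    norm_mul, norm_mul, norm_pow, div_eq_mul_inv (_ * _ * _)]
  calc 2 * ‖Complex.Gamma (1 / 2 + Complex.I * r)‖⁻¹ * (‖(4 : ℂ) ^ (s - 1) / (2 * Real.pi)‖ *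
        (‖Complex.Gamma (s / 2)‖ ^ 2 * ‖Complex.Gamma (s / 2 + Complex.I * r)‖ *
          ‖Complex.Gamma (s / 2 - Complex.I * r)‖ * ‖Complex.Gamma s‖⁻¹))
      ≤ 2 * ‖Complex.Gamma (1 / 2 + Complex.I * r)‖⁻¹ * (1 *
        ((K * ((1 + |t / 2|) ^ (-(1 / 4) : ℝ) * Real.exp (-(Real.pi / 2) * |t / 2|))) ^ 2 *
          (K * ((1 + |t / 2 + r|) ^ (-(1 / 4) : ℝ) * Real.exp (-(Real.pi / 2) * |t / 2 + r|))) *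
          (K * ((1 + |t / 2 - r|) ^ (-(1 / 4) : ℝ) * Real.exp (-(Real.pi / 2) * |t / 2 - r|))) *
          Real.exp (Real.pi / 2 * |t|))) := by
        gcongr
    _ = ‖Complex.Gamma (1 / 2 + Complex.I * r)‖⁻¹ * (2 * K ^ 4 *
        (((1 + |t / 2|) ^ (-(1 / 4) : ℝ)) ^ 2 * (1 + |t / 2 + r|) ^ (-(1 / 4) : ℝ) *
          (1 + |t / 2 - r|) ^ (-(1 / 4) : ℝ) *
          (Real.exp (-(Real.pi / 2) * |t / 2|) ^ 2 * Real.exp (-(Real.pi / 2) * |t / 2 + r|) *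
            Real.exp (-(Real.pi / 2) * |t / 2 - r|) * Real.exp (Real.pi / 2 * |t|)))) := by ring
    _ = ‖Complex.Gamma (1 / 2 + Complex.I * r)‖⁻¹ * (2 * K ^ 4 *
        (((1 + |t / 2|) ^ (-(1 / 4) : ℝ)) ^ 2 * (1 + |t / 2 + r|) ^ (-(1 / 4) : ℝ) *
          (1 + |t / 2 - r|) ^ (-(1 / 4) : ℝ) *
          Real.exp (-(Real.pi / 2) * (|t / 2 + r| + |t / 2 - r|)))) := by
        rw [← Real.exp_nat_mul, ← Real.exp_add, ← Real.exp_add, ← Real.exp_add, ← ht2]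
        congr 4
        push_cast
        ring
    _ ≤ ‖Complex.Gamma (1 / 2 + Complex.I * r)‖⁻¹ * (2 * K ^ 4 *
        ((2 * (1 + |t|) ^ (-(1 / 2) : ℝ)) * (2 * (1 + |2 * r + t|) ^ (-(1 / 4) : ℝ)) *
          (2 * (1 + |2 * r - t|) ^ (-(1 / 4) : ℝ)) *
          Real.exp (-(Real.pi / 2) * (|t / 2 + r| + |t / 2 - r|)))) := by gcongr
    _ = _ := by ring

theorem mainTheorem6 (k : ℤ) :
    (∀ r t : ℝ, IntegrableOn (whittakerIntegrand k r (-r) t) (Set.Ioi (0 : ℝ))) ∧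
    ∃ C : ℝ, 0 < C ∧ ∀ r t : ℝ,
      ‖whittakerIntegral k r (-r) t‖ ≤
        C * (1 + |t|) ^ (-(1 / 2) : ℝ) * (1 + |2 * r + t|) ^ (-(1 / 4) : ℝ) *
          (1 + |2 * r - t|) ^ (-(1 / 4) : ℝ) := by
  refine ⟨integrableOn_whittakerIntegrand k, ?_⟩
  obtain ⟨A, hA, hA'⟩ := evenMellinBound k.natAbs 0
  obtain ⟨B, hB, hB'⟩ := exists_norm_evenMellin_zero_le
  obtain ⟨D, hD, hD'⟩ := exists_pow_mul_exp_le k.natAbs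
  -- `A` is only known to be nonnegative; `A + 1` keeps the constant positive.
  refine ⟨(A + 1) * B * D, by positivity, fun r t => ?_⟩
  have hk : evenMellin r k (-(1 / 2) + Complex.I * t) =
      evenMellin r k.natAbs (-(1 / 2) + Complex.I * t) := by
    rcases Int.natAbs_eq k with h | h
    · rw [← h]
    · conv_lhs => rw [h, evenMellin_neg]
  have h1 := (hA' r t).1
  simp only [Nat.cast_zero, mul_zero, add_zero, pow_zero, mul_one] at h1
  rw [whittakerIntegral_eq, norm_mul, norm_inv, hk]
  set G := ‖Complex.Gamma (1 / 2 + Complex.I * r)‖⁻¹ with hG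
  set L := ((1 + |r| + |t|) / (1 + |r|)) ^ k.natAbs with hL
  set P := (1 + |t|) ^ (-(1 / 2) : ℝ) * (1 + |2 * r + t|) ^ (-(1 / 4) : ℝ) *
    (1 + |2 * r - t|) ^ (-(1 / 4) : ℝ) with hP
  have hL0 : 0 ≤ L := by positivity
  have hP0 : 0 ≤ P := by positivity
  -- One factor `G` normalises W_{0,ir} in the integrand, the other comes from S_0; together they
  -- produce the growth e^{π|r|} balanced by `exists_pow_mul_exp_le`.
  have hGG : G * G ≤ Real.exp (Real.pi * |r|) := by
    have := inv_norm_Gamma_half_sq_le r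
    rwa [← inv_pow, sq] at this
  calc G * ‖evenMellin r k.natAbs (-(1 / 2) + Complex.I * t)‖
      ≤ G * (A * (L * (G * (B * (P *
        Real.exp (-(Real.pi / 2) * (|t / 2 + r| + |t / 2 - r|))))))) := by
        refine mul_le_mul_of_nonneg_left (h1.trans ?_) (by positivity)
        gcongr
        exact hB' r t
    _ = A * B * P * (L * ((G * G) *
        Real.exp (-(Real.pi / 2) * (|t / 2 + r| + |t / 2 - r|)))) := by ring
    _ ≤ A * B * P * (L * (Real.exp (Real.pi * |r|) *
        Real.exp (-(Real.pi / 2) * (|t / 2 + r| + |t / 2 - r|)))) := by gcongr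
    _ = A * B * P * (L *
        Real.exp (Real.pi * |r| - Real.pi / 2 * (|t / 2 + r| + |t / 2 - r|))) := by
        rw [← Real.exp_add]; congr 3; ring
    _ ≤ (A + 1) * B * P * D := by
        gcongr
        · linarith
        · exact hD' r t
    _ = _ := by rw [hP]; ring
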